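/- \textbf{Setting.} The spherically symmetric Einstein--Vlasov system in Schwarzschild coordinates, for metric coefficients $\lambda(t,r),\mu(t,r)$ and a distribution function $f(t,r,w,F)$ ($r\ge 0$, $w\in\mathbb R$, $F\ge 0$), with $E=E(r,w,F)=\sqrt{1+w^2+F/r^2}$, consists of $$e^{-2\lambda}(2r\lambda_r-1)+1=8\pi r^2\rho,\qquad e^{-2\lambda}(2r\mu_r+1)-1=8\pi r^2p,\qquad \lambda_t=-4\pi re^{\lambda+\mu}j,$$ $$e^{-2\lambda}\Big(\mu_{rr}+(\mu_r-\lambda_r)\big(\mu_r+\tfrac1r\big)\Big)-e^{-2\mu}\big(\lambda_{tt}+\lambda_t(\lambda_t-\mu_t)\big)=4\pi q,$$ $$\partial_tf+e^{\mu-\lambda}\frac wE\,\partial_rf-\Big(\lambda_tw+e^{\mu-\lambda}\mu_rE-e^{\mu-\lambda}\frac{F}{r^3E}\Big)\partial_wf=0,$$ where $$\rho=\frac{\pi}{r^2}\int_{-\infty}^\infty\!\int_0^\infty Ef\,dF\,dw,\quad p=\frac{\pi}{r^2}\int_{-\infty}^\infty\!\int_0^\infty\frac{w^2}{E}f\,dF\,dw,\quad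 j=\frac{\pi}{r^2}\int_{-\infty}^\infty\!\int_0^\infty wf\,dF\,dw,\quad q=\frac{\pi}{r^4}\int_{-\infty}^\infty\!\int_0^\infty\frac FE f\,dF\,dw,$$ with boundary conditions $\lim_{r\to\infty}\lambda(t,r)=\lim_{r\to\infty}\mu(t,r)=\lambda(t,0)=0$. Put $$m(t,r)=4\pi\int_0^r\eta^2\rho(t,\eta)\,d\eta,\qquad j^+(t,r)=\frac{\pi}{r^2}\int_0^\infty\!\int_0^\infty wf\,dF\,dw,\qquad \hat\mu(t,r)=-\int_r^\infty e^{2\lambda(t,\eta)}\frac{m(t,\eta)}{\eta^2}\,d\eta .$$ Regular initial data are nonnegative, compactly supported smooth functions $f_0(r,w,F)$ with $4\pi^2\int_0^r\int_{-\infty}^\infty\int_0^\infty E f_0\,dF\,dw\,d\eta<r/2$ for all $r>0$. For $R_->0$ and $F_->0$, $I_{R_-,F_-}$ is the set of regular initial data such that $f_0=0$ whenever $r\le R_-$ and $f_0=0$ whenever $F\le F_-$. A \emph{regular solution} on $[0,T[$ is a solution such that $f$ is $C^1$ (and continuous up to $F=0$) and, uniformly on each $[0,T']$ with $T'<T$,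 has compact support in $r$ and $w^2+F/r^2$, and such that $\lambda,\mu,\lambda_r,\mu_r,\lambda_t$ are $C^1$ on $[0,T[\times[0,\infty[$. A \emph{characteristic} starting at $(r,w,F)$ is a pair $(R(s),W(s))$ with $R(0)=r$, $W(0)=w$, $R(s)>0$ and, on $[0,T[$, $$\frac{dR}{ds}=e^{(\mu-\lambda)(s,R)}\frac{W}{E},\qquad \frac{dW}{ds}=-\lambda_t(s,R)W-e^{(\mu-\lambda)(s,R)}\mu_r(s,R)E+e^{(\mu-\lambda)(s,R)}\frac{F}{R^3E},\qquad E=E(R,W,F).$$ \textbf{Theorem 3.} Let $0<T<\infty$, let $R_-,F_->0$, let $f_0\in I_{R_-,F_-}$ satisfy $f_0(r,w,F)=0$ whenever $w>0$, and let $(f,\lambda,\mu)$ be a regular solution on $[0,T[$ with $f(0)=f_0$. Assume that $j^+(t,r)=0$ and $r\ge 3m(t,r)$ for all $t\in[0,T[$ and $r>0$. Let $(R(s),W(s),F)$ be any characteristic on $[0,T[$ starting at a point $(r,w,F)$ with $f_0(r,w,F)\ne 0$, and assume that $$\frac{d}{ds}\Big(e^{\hat\mu(s,R(s))}E(R(s),W(s),F)\Big)\ge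 0\qquad\text{for all } s\in[0,T[.$$ Then there exists $\epsilon>0$ such that $R(s)>\epsilon$ for all $s\in[0,T[$. -/

import Mathlib

open Set Filter Topology MeasureTheory
open scoped ContDiff

noncomputable section

namespace EinsteinVlasov

/-! Metric coefficients are functions `g t r` of time `t ≥ 0` and areal radius `r ≥ 0`; the
distribution function is `f t r w F`, with radial momentum `w` and squared angular momentum
`F ≥ 0`.  Values at negative `t`, `r` or `F` never matter. -/

/-- Time derivative of `g` (one-sided at `t = 0`). -/
def dt (g : ℝ → ℝ → ℝ) (t r : ℝ) : ℝ := derivWithin (fun τ => g τ r) (Ici 0) t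

/-- Radial derivative of `g` (one-sided at `r = 0`). -/
def dr (g : ℝ → ℝ → ℝ) (t r : ℝ) : ℝ := derivWithin (fun η => g t η) (Ici 0) r

/-- The particle energy `E(r, w, F) = √(1 + w² + F / r²)`. -/
def energy (r w F : ℝ) : ℝ := Real.sqrt (1 + w ^ 2 + F / r ^ 2)

/-- Energy density. -/
def rho (f : ℝ → ℝ → ℝ → ℝ → ℝ) (t r : ℝ) : ℝ :=
  Real.pi / r ^ 2 * ∫ w : ℝ, ∫ F in Ioi (0 : ℝ), energy r w F * f t r w F

/-- Radial pressure. -/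
def pres (f : ℝ → ℝ → ℝ → ℝ → ℝ) (t r : ℝ) : ℝ :=
  Real.pi / r ^ 2 * ∫ w : ℝ, ∫ F in Ioi (0 : ℝ), w ^ 2 / energy r w F * f t r w F

/-- Radial current. -/
def cur (f : ℝ → ℝ → ℝ → ℝ → ℝ) (t r : ℝ) : ℝ :=
  Real.pi / r ^ 2 * ∫ w : ℝ, ∫ F in Ioi (0 : ℝ), w * f t r w F

/-- Outgoing part `j⁺` of the radial current. -/
def curPlus (f : ℝ → ℝ → ℝ → ℝ → ℝ) (t r : ℝ) : ℝ :=
  Real.pi / r ^ 2 * ∫ w in Ioi (0 : ℝ), ∫ F in Ioi (0 : ℝ), w * f t r w F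

/-- Tangential pressure term `q`. -/
def tang (f : ℝ → ℝ → ℝ → ℝ → ℝ) (t r : ℝ) : ℝ :=
  Real.pi / r ^ 4 * ∫ w : ℝ, ∫ F in Ioi (0 : ℝ), F / energy r w F * f t r w F

/-- The mass function `m(t, r) = 4π ∫₀ʳ η² ρ(t, η) dη`. -/
def mass (f : ℝ → ℝ → ℝ → ℝ → ℝ) (t r : ℝ) : ℝ :=
  4 * Real.pi * ∫ η in (0 : ℝ)..r, η ^ 2 * rho f t η

/-- `μ̂(t, r) = -∫ᵣ^∞ e^{2λ(t, η)} m(t, η) / η² dη`. -/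
def muHat (f : ℝ → ℝ → ℝ → ℝ → ℝ) (lam : ℝ → ℝ → ℝ) (t r : ℝ) : ℝ :=
  -∫ η in Ioi r, Real.exp (2 * lam t η) * mass f t η / η ^ 2

/-- Regular initial data: nonnegative, compactly supported smooth functions `f₀(r, w, F)` on
`r ≥ 0`, `F ≥ 0` such that no trapped surface is present initially. -/
structure IsRegularData (f₀ : ℝ → ℝ → ℝ → ℝ) : Prop where
  nonneg : ∀ r w F, 0 ≤ r → 0 ≤ F → 0 ≤ f₀ r w F
  smooth : ContDiffOn ℝ ∞ (fun z : ℝ × ℝ × ℝ => f₀ z.1 z.2.1 z.2.2)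
    (Ici 0 ×ˢ (univ ×ˢ Ici 0))
  compact_support : ∃ K : ℝ, ∀ r w F, 0 ≤ r → 0 ≤ F → f₀ r w F ≠ 0 → r ≤ K ∧ |w| ≤ K ∧ F ≤ K
  untrapped : ∀ r, 0 < r →
    4 * Real.pi ^ 2 *
      (∫ η in (0 : ℝ)..r, ∫ w : ℝ, ∫ F in Ioi (0 : ℝ), energy η w F * f₀ η w F) < r / 2

/-- The class `I_{R₋, F₋}` of regular initial data with radial cut-off `R₋` and angular momentum
cut-off `F₋`. -/
structure IsCutoffData (Rm Fm : ℝ) (f₀ : ℝ → ℝ → ℝ → ℝ) : Prop extends IsRegularData f₀ where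
  radial_cutoff : ∀ r w F, 0 ≤ r → 0 ≤ F → r ≤ Rm → f₀ r w F = 0
  angular_cutoff : ∀ r w F, 0 ≤ r → 0 ≤ F → F ≤ Fm → f₀ r w F = 0

/-- `(f, λ, μ)` is a regular (classical) solution on `[0, T[` of the spherically symmetric
Einstein-Vlasov system in Schwarzschild coordinates, with `f(0) = f₀`. -/
structure IsRegularSolution (T : ℝ) (f₀ : ℝ → ℝ → ℝ → ℝ) (f : ℝ → ℝ → ℝ → ℝ → ℝ)
    (lam mu : ℝ → ℝ → ℝ) : Prop where
  /-- `f` is continuous up to `F = 0` and continuously differentiable where `F > 0`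
  (a function which is `C¹` in Cartesian variables need not be `C¹` in `F` up to `F = 0`). -/
  f_cont : ContinuousOn (fun z : ℝ × ℝ × ℝ × ℝ => f z.1 z.2.1 z.2.2.1 z.2.2.2)
    (Ico 0 T ×ˢ (Ioi 0 ×ˢ (univ ×ˢ Ici 0)))
  f_C1 : ContDiffOn ℝ 1 (fun z : ℝ × ℝ × ℝ × ℝ => f z.1 z.2.1 z.2.2.1 z.2.2.2)
    (Ico 0 T ×ˢ (Ioi 0 ×ˢ (univ ×ˢ Ioi 0)))
  /-- On compact time intervals, `f` has compact support in position and momentum `v`;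
  here `|x| = r` and `|v|² = w² + F / r²`. -/
  f_support : ∀ T' < T, ∃ K : ℝ, ∀ t r w F, 0 ≤ t → t ≤ T' → 0 < r → 0 ≤ F →
    f t r w F ≠ 0 → r ≤ K ∧ w ^ 2 + F / r ^ 2 ≤ K ^ 2
  lam_C1 : ContDiffOn ℝ 1 (fun z : ℝ × ℝ => lam z.1 z.2) (Ico 0 T ×ˢ Ici 0)
  mu_C1 : ContDiffOn ℝ 1 (fun z : ℝ × ℝ => mu z.1 z.2) (Ico 0 T ×ˢ Ici 0)
  lam_r_C1 : ContDiffOn ℝ 1 (fun z : ℝ × ℝ => dr lam z.1 z.2) (Ico 0 T ×ˢ Ici 0)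
  mu_r_C1 : ContDiffOn ℝ 1 (fun z : ℝ × ℝ => dr mu z.1 z.2) (Ico 0 T ×ˢ Ici 0)
  lam_t_C1 : ContDiffOn ℝ 1 (fun z : ℝ × ℝ => dt lam z.1 z.2) (Ico 0 T ×ˢ Ici 0)
  initial : ∀ r w F, 0 < r → 0 ≤ F → f 0 r w F = f₀ r w F
  /-- The Vlasov equation. -/
  vlasov : ∀ t r w F, 0 ≤ t → t < T → 0 < r → 0 < F →
    derivWithin (fun τ => f τ r w F) (Ici 0) t
      + Real.exp (mu t r - lam t r) * (w / energy r w F) * deriv (fun η => f t η w F) r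
      - (dt lam t r * w + Real.exp (mu t r - lam t r) * dr mu t r * energy r w F
          - Real.exp (mu t r - lam t r) * (F / (r ^ 3 * energy r w F)))
        * deriv (fun u => f t r u F) w = 0
  /-- The four Einstein equations. -/
  einstein₁ : ∀ t r, 0 ≤ t → t < T → 0 < r →
    Real.exp (-2 * lam t r) * (2 * r * dr lam t r - 1) + 1 = 8 * Real.pi * r ^ 2 * rho f t r
  einstein₂ : ∀ t r, 0 ≤ t → t < T → 0 < r →
    Real.exp (-2 * lam t r) * (2 * r * dr mu t r + 1) - 1 = 8 * Real.pi * r ^ 2 * pres f t r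
  einstein₃ : ∀ t r, 0 ≤ t → t < T → 0 < r →
    dt lam t r = -4 * Real.pi * r * Real.exp (lam t r + mu t r) * cur f t r
  einstein₄ : ∀ t r, 0 ≤ t → t < T → 0 < r →
    Real.exp (-2 * lam t r)
        * (dr (dr mu) t r + (dr mu t r - dr lam t r) * (dr mu t r + 1 / r))
      - Real.exp (-2 * mu t r)
        * (dt (dt lam) t r + dt lam t r * (dt lam t r - dt mu t r))
      = 4 * Real.pi * tang f t r
  /-- Boundary conditions: asymptotic flatness and a regular centre. -/
  lam_infty : ∀ t, 0 ≤ t → t < T → Tendsto (lam t) atTop (𝓝 0)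
  mu_infty : ∀ t, 0 ≤ t → t < T → Tendsto (mu t) atTop (𝓝 0)
  lam_centre : ∀ t, 0 ≤ t → t < T → lam t 0 = 0

/-- `(R(s), W(s), F)` solves the characteristic system on `[0, T[` (in the phase space `r > 0`)
and starts at `(r, w, F)` at time `0`. -/
structure IsCharacteristic (T : ℝ) (lam mu : ℝ → ℝ → ℝ) (r w F : ℝ) (R W : ℝ → ℝ) : Prop where
  start_R : R 0 = r
  start_W : W 0 = w
  pos : ∀ s ∈ Ico 0 T, 0 < R s
  deriv_R : ∀ s ∈ Ico 0 T, HasDerivWithinAt R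
    (Real.exp (mu s (R s) - lam s (R s)) * (W s / energy (R s) (W s) F)) (Ici 0) s
  deriv_W : ∀ s ∈ Ico 0 T, HasDerivWithinAt W
    (-dt lam s (R s) * W s
      - Real.exp (mu s (R s) - lam s (R s)) * dr mu s (R s) * energy (R s) (W s) F
      + Real.exp (mu s (R s) - lam s (R s)) * (F / (R s ^ 3 * energy (R s) (W s) F))) (Ici 0) s

end EinsteinVlasov

end

noncomputable section

namespace EinsteinVlasov

theorem hasDerivAt_fst_of_contDiffOn {g : ℝ → ℝ → ℝ} {J : Set ℝ} (hJ : IsOpen J)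
    (hg : ContDiffOn ℝ 1 (fun z : ℝ × ℝ => g z.1 z.2) (J ×ˢ Ioi 0)) {s η : ℝ} (hs : s ∈ J)
    (hη : 0 < η) :
    HasDerivAt (fun τ => g τ η) (fderiv ℝ (fun z : ℝ × ℝ => g z.1 z.2) (s, η) (1, 0)) s := by
  have h1 : HasFDerivAt (fun z : ℝ × ℝ => g z.1 z.2)
      (fderiv ℝ (fun z : ℝ × ℝ => g z.1 z.2) (s, η)) (s, η) :=
    ((hg.contDiffAt ((hJ.prod isOpen_Ioi).mem_nhds (mk_mem_prod hs hη))).differentiableAt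
      one_ne_zero).hasFDerivAt
  exact h1.comp_hasDerivAt (f := fun τ : ℝ => (τ, η)) s
    ((hasDerivAt_id s).prodMk (hasDerivAt_const s η))

theorem hasDerivAt_snd_of_contDiffOn {g : ℝ → ℝ → ℝ} {J : Set ℝ} (hJ : IsOpen J)
    (hg : ContDiffOn ℝ 1 (fun z : ℝ × ℝ => g z.1 z.2) (J ×ˢ Ioi 0)) {s η : ℝ} (hs : s ∈ J)
    (hη : 0 < η) :
    HasDerivAt (fun τ => g s τ) (fderiv ℝ (fun z : ℝ × ℝ => g z.1 z.2) (s, η) (0, 1)) η := by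
  have h1 : HasFDerivAt (fun z : ℝ × ℝ => g z.1 z.2)
      (fderiv ℝ (fun z : ℝ × ℝ => g z.1 z.2) (s, η)) (s, η) :=
    ((hg.contDiffAt ((hJ.prod isOpen_Ioi).mem_nhds (mk_mem_prod hs hη))).differentiableAt
      one_ne_zero).hasFDerivAt
  exact h1.comp_hasDerivAt (f := fun τ : ℝ => (s, τ)) η
    ((hasDerivAt_const η s).prodMk (hasDerivAt_id η))

theorem continuousOn_fderiv_apply {g : ℝ → ℝ → ℝ} {J : Set ℝ} (hJ : IsOpen J)
    (hg : ContDiffOn ℝ 1 (fun z : ℝ × ℝ => g z.1 z.2) (J ×ˢ Ioi 0)) (v : ℝ × ℝ) :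
    ContinuousOn (fun z => fderiv ℝ (fun z : ℝ × ℝ => g z.1 z.2) z v) (J ×ˢ Ioi 0) :=
  (hg.continuousOn_fderiv_of_isOpen (hJ.prod isOpen_Ioi) le_rfl).clm_apply continuousOn_const

theorem continuousOn_deriv_fst {g : ℝ → ℝ → ℝ} {J : Set ℝ} (hJ : IsOpen J)
    (hg : ContDiffOn ℝ 1 (fun z : ℝ × ℝ => g z.1 z.2) (J ×ˢ Ioi 0)) {s : ℝ} (hs : s ∈ J) :
    ContinuousOn (fun η => deriv (fun τ => g τ η) s) (Ioi 0) := by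
  have h : ContinuousOn (fun η : ℝ => fderiv ℝ (fun z : ℝ × ℝ => g z.1 z.2) (s, η) (1, 0))
      (Ioi 0) :=
    (continuousOn_fderiv_apply hJ hg (1, 0)).comp (f := fun η : ℝ => (s, η)) (by fun_prop)
      fun η hη => ⟨hs, hη⟩
  exact h.congr fun η hη => (hasDerivAt_fst_of_contDiffOn hJ hg hs hη).deriv

theorem continuousOn_deriv_snd {g : ℝ → ℝ → ℝ} {J : Set ℝ} (hJ : IsOpen J)
    (hg : ContDiffOn ℝ 1 (fun z : ℝ × ℝ => g z.1 z.2) (J ×ˢ Ioi 0)) {s : ℝ} (hs : s ∈ J) :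
    ContinuousOn (fun η => deriv (fun τ => g s τ) η) (Ioi 0) := by
  have h : ContinuousOn (fun η : ℝ => fderiv ℝ (fun z : ℝ × ℝ => g z.1 z.2) (s, η) (0, 1))
      (Ioi 0) :=
    (continuousOn_fderiv_apply hJ hg (0, 1)).comp (f := fun η : ℝ => (s, η)) (by fun_prop)
      fun η hη => ⟨hs, hη⟩
  exact h.congr fun η hη => (hasDerivAt_snd_of_contDiffOn hJ hg hs hη).deriv

theorem uIcc_subset_Ioi_zero {a b : ℝ} (ha : 0 < a) (hb : 0 < b) : uIcc a b ⊆ Ioi 0 :=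
  fun _ hx => lt_of_lt_of_le (lt_min ha hb) hx.1

theorem continuousOn_slice {g : ℝ → ℝ → ℝ} {J : Set ℝ}
    (hg : ContinuousOn (fun z : ℝ × ℝ => g z.1 z.2) (J ×ˢ Ioi 0)) {s : ℝ} (hs : s ∈ J) :
    ContinuousOn (g s) (Ioi 0) :=
  hg.comp (f := fun η : ℝ => (s, η)) (by fun_prop) fun _ hη => ⟨hs, hη⟩

theorem intervalIntegrable_of_continuousOn_Ioi {u : ℝ → ℝ} (hu : ContinuousOn u (Ioi 0))
    {a b : ℝ} (ha : 0 < a) (hb : 0 < b) : IntervalIntegrable u volume a b :=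
  (hu.mono (uIcc_subset_Ioi_zero ha hb)).intervalIntegrable

/-- Differentiation under the integral sign for a `C¹` integrand and fixed end points. -/
theorem hasDerivAt_integral_fixed {g : ℝ → ℝ → ℝ} {J : Set ℝ} (hJ : IsOpen J)
    (hg : ContDiffOn ℝ 1 (fun z : ℝ × ℝ => g z.1 z.2) (J ×ˢ Ioi 0)) {s a b : ℝ} (hs : s ∈ J)
    (ha : 0 < a) (hb : 0 < b) :
    HasDerivAt (fun σ => ∫ η in a..b, g σ η) (∫ η in a..b, deriv (fun τ => g τ η) s) s := by
  have hsub := uIcc_subset_Ioi_zero ha hb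
  obtain ⟨δ, hδ, hball⟩ := Metric.nhds_basis_closedBall.mem_iff.1 (hJ.mem_nhds hs)
  have hcomp : IsCompact (Metric.closedBall s δ ×ˢ uIcc a b) :=
    (isCompact_closedBall s δ).prod isCompact_uIcc
  obtain ⟨C, hC⟩ := hcomp.exists_bound_of_continuousOn
    ((continuousOn_fderiv_apply hJ hg (1, 0)).mono (prod_mono hball hsub))
  have hint : ∀ σ ∈ J, IntervalIntegrable (g σ) volume a b := fun σ hσ =>
    intervalIntegrable_of_continuousOn_Ioi (continuousOn_slice hg.continuousOn hσ) ha hb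
  refine (intervalIntegral.hasDerivAt_integral_of_dominated_loc_of_deriv_le
    (F' := fun σ η => deriv (fun τ => g τ η) σ) (bound := fun _ => C)
    (Metric.closedBall_mem_nhds s hδ) ?_ (hint s hs) ?_ ?_ ?_ ?_).2
  · filter_upwards [hJ.mem_nhds hs] with σ hσ
    exact (intervalIntegrable_iff.1 (hint σ hσ)).aestronglyMeasurable
  · exact (intervalIntegrable_iff.1 (intervalIntegrable_of_continuousOn_Ioi
      (continuousOn_deriv_fst hJ hg hs) ha hb)).aestronglyMeasurable
  · refine Eventually.of_forall fun η hη σ hσ => ?_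
    have hη' := uIoc_subset_uIcc hη
    rw [(hasDerivAt_fst_of_contDiffOn hJ hg (hball hσ) (hsub hη')).deriv]
    exact hC (σ, η) ⟨hσ, hη'⟩
  · exact intervalIntegrable_const
  · refine Eventually.of_forall fun η hη σ hσ => ?_
    exact (hasDerivAt_fst_of_contDiffOn hJ hg (hball hσ)
      (hsub (uIoc_subset_uIcc hη))).differentiableAt.hasDerivAt

/-- Derivative of an integral with respect to its moving end point, for an integrand which may also
depend on the parameter. -/
theorem hasDerivAt_integral_endpoint {g : ℝ → ℝ → ℝ} {J : Set ℝ} (hJ : IsOpen J)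
    (hg : ContinuousOn (fun z : ℝ × ℝ => g z.1 z.2) (J ×ˢ Ioi 0)) {R : ℝ → ℝ} {R' s : ℝ}
    (hs : s ∈ J) (hR : HasDerivAt R R' s) (hpos : 0 < R s) :
    HasDerivAt (fun σ => ∫ η in R s..R σ, g σ η) (g s (R s) * R') s := by
  have hcont : ContinuousAt (fun z : ℝ × ℝ => g z.1 z.2) (s, R s) :=
    hg.continuousAt ((hJ.prod isOpen_Ioi).mem_nhds ⟨hs, hpos⟩)
  have key : (fun σ => (∫ η in R s..R σ, g σ η) - g s (R s) * (R σ - R s)) =o[𝓝 s]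
      fun σ => R σ - R s := by
    refine Asymptotics.isLittleO_iff.2 fun ε hε => ?_
    obtain ⟨δ, hδ, hball⟩ := Metric.continuousAt_iff.1 hcont ε hε
    have h1 : ∀ᶠ σ in 𝓝 s, dist σ s < δ := Metric.ball_mem_nhds s hδ
    have h2 : ∀ᶠ σ in 𝓝 s, dist (R σ) (R s) < δ :=
      hR.continuousAt.eventually (Metric.ball_mem_nhds _ hδ)
    have h3 : ∀ᶠ σ in 𝓝 s, 0 < R σ := hR.continuousAt.eventually (lt_mem_nhds hpos)
    filter_upwards [h1, h2, h3, hJ.mem_nhds hs] with σ h1 h2 h3 h4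
    have hint := intervalIntegrable_of_continuousOn_Ioi (continuousOn_slice hg h4) hpos h3
    have : (∫ η in R s..R σ, g σ η) - g s (R s) * (R σ - R s)
        = ∫ η in R s..R σ, (g σ η - g s (R s)) := by
      rw [intervalIntegral.integral_sub hint intervalIntegrable_const]
      simp [mul_comm]
    rw [this]
    refine intervalIntegral.norm_integral_le_of_norm_le_const fun η hη => ?_
    have hη' := uIoc_subset_uIcc hη
    have hd : dist η (R s) < δ := by
      refine lt_of_le_of_lt ?_ h2
      rw [Real.dist_eq, Real.dist_eq]
      have := abs_sub_left_of_mem_uIcc hη'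
      exact this
    have := hball (x := (σ, η)) (by rw [Prod.dist_eq]; exact max_lt h1 hd)
    exact this.le
  have h5 : (fun σ => R σ - R s) =O[𝓝 s] fun σ => σ - s := hR.isBigO_sub
  have h6 := key.trans_isBigO h5
  rw [hasDerivAt_iff_isLittleO]
  have h7 := (hasDerivAt_iff_isLittleO.1 hR).const_mul_left (g s (R s))
  refine (h6.add h7).congr_left fun σ => ?_
  simp only [intervalIntegral.integral_same, smul_eq_mul]
  ring

theorem hasDerivAt_integral_moving {g : ℝ → ℝ → ℝ} {J : Set ℝ} (hJ : IsOpen J)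
    (hg : ContDiffOn ℝ 1 (fun z : ℝ × ℝ => g z.1 z.2) (J ×ˢ Ioi 0)) {R : ℝ → ℝ} {R' s K : ℝ}
    (hs : s ∈ J) (hR : HasDerivAt R R' s) (hpos : 0 < R s) (hK : 0 < K) :
    HasDerivAt (fun σ => ∫ η in R σ..K, g σ η)
      ((∫ η in R s..K, deriv (fun τ => g τ η) s) - g s (R s) * R') s := by
  refine ((hasDerivAt_integral_fixed hJ hg hs hpos hK).sub
    (hasDerivAt_integral_endpoint hJ hg.continuousOn hs hR hpos)).congr_of_eventuallyEq ?_
  have h3 : ∀ᶠ σ in 𝓝 s, 0 < R σ := hR.continuousAt.eventually (lt_mem_nhds hpos)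
  filter_upwards [h3, hJ.mem_nhds hs] with σ h3 h4
  have hc := continuousOn_slice hg.continuousOn h4
  simp only [Pi.sub_apply]
  rw [eq_sub_iff_add_eq, add_comm]
  exact intervalIntegral.integral_add_adjacent_intervals
    (intervalIntegrable_of_continuousOn_Ioi hc hpos h3)
    (intervalIntegrable_of_continuousOn_Ioi hc h3 hK)

variable {T Rm Fm : ℝ} {f₀ : ℝ → ℝ → ℝ → ℝ} {f : ℝ → ℝ → ℝ → ℝ → ℝ} {lam mu : ℝ → ℝ → ℝ}

theorem derivWithin_Ici_eq_deriv (u : ℝ → ℝ) {a t : ℝ} (h : a < t) :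
    derivWithin u (Ici a) t = deriv u t :=
  derivWithin_of_mem_nhds (Ici_mem_nhds h)

theorem energy_pos {r w F : ℝ} (hF : 0 ≤ F) : 0 < energy r w F :=
  Real.sqrt_pos.2 (by positivity)

theorem energy_sq {r w F : ℝ} (hF : 0 ≤ F) : energy r w F ^ 2 = 1 + w ^ 2 + F / r ^ 2 :=
  Real.sq_sqrt (by positivity)

theorem abs_le_energy {r w F : ℝ} (hF : 0 ≤ F) : |w| ≤ energy r w F :=
  Real.abs_le_sqrt (by have : 0 ≤ F / r ^ 2 := by positivity
                       linarith)

theorem IsRegularSolution.differentiableAt_f (hsol : IsRegularSolution T f₀ f lam mu)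
    {t r w F : ℝ} (ht : 0 < t) (htT : t < T) (hr : 0 < r) (hF : 0 < F) :
    DifferentiableAt ℝ (fun z : ℝ × ℝ × ℝ × ℝ => f z.1 z.2.1 z.2.2.1 z.2.2.2) (t, r, w, F) := by
  have hnhds : Ico 0 T ×ˢ (Ioi 0 ×ˢ (univ ×ˢ Ioi 0)) ∈ 𝓝 ((t, r, w, F) : ℝ × ℝ × ℝ × ℝ) :=
    prod_mem_nhds (Ico_mem_nhds ht htT) (prod_mem_nhds (Ioi_mem_nhds hr)
      (prod_mem_nhds univ_mem (Ioi_mem_nhds hF)))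
  exact (hsol.f_C1.contDiffAt hnhds).differentiableAt one_ne_zero

/-- Momenta and radii in the support of `f` for a fixed angular momentum `F > 0`. -/
theorem IsRegularSolution.support_bounds (hsol : IsRegularSolution T f₀ f lam mu)
    {T' F : ℝ} (hT' : T' < T) (hF : 0 < F) :
    ∃ K δ : ℝ, 0 < K ∧ 0 < δ ∧ ∀ t r w, 0 ≤ t → t ≤ T' → 0 < r → f t r w F ≠ 0 →
      δ < r ∧ r < K ∧ -K < w ∧ w < K := by
  obtain ⟨K, hK⟩ := hsol.f_support T' hT'
  have hK1 : 0 < |K| + 1 := by positivity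
  refine ⟨|K| + 1, √F / (|K| + 1), hK1, by positivity, fun t r w ht htT' hr hne => ?_⟩
  obtain ⟨h1, h2⟩ := hK t r w F ht htT' hr hF.le hne
  have h3 : K ^ 2 < (|K| + 1) ^ 2 := by
    rw [← sq_abs K]
    nlinarith [abs_nonneg K]
  have h4 : 0 ≤ F / r ^ 2 := by positivity
  have h5 : |w| < |K| + 1 := abs_lt_of_sq_lt_sq (by nlinarith) hK1.le
  refine ⟨?_, by linarith [le_abs_self K], (abs_lt.1 h5).1, (abs_lt.1 h5).2⟩
  have h6 : F / r ^ 2 < (|K| + 1) ^ 2 := by nlinarith [sq_nonneg w]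
  rw [div_lt_iff₀ (by positivity)] at h6
  rw [div_lt_iff₀ hK1]
  rw [Real.sqrt_lt' (by positivity)]
  linarith [mul_pow (r) (|K| + 1) 2]

/-- Weak minimum principle for the Vlasov equation at a fixed angular momentum. -/
theorem IsRegularSolution.nonneg_of_initial (hsol : IsRegularSolution T f₀ f lam mu)
    {F c : ℝ} (hF : 0 < F) (h0 : ∀ r w, 0 < r → 0 ≤ c * f 0 r w F) {t r w : ℝ} (ht : 0 ≤ t)
    (htT : t < T) (hr : 0 < r) : 0 ≤ c * f t r w F := by
  by_contra hneg
  rw [not_le] at hneg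
  obtain ⟨K, δ, hK, hδ, hsupp⟩ := hsol.support_bounds htT hF
  set ε : ℝ := -(c * f t r w F) / (2 * (t + 1)) with hε_def
  have hε : 0 < ε := div_pos (by linarith) (by linarith)
  have hεt : ε * (2 * (t + 1)) = -(c * f t r w F) := by
    rw [hε_def]; field_simp
  let φ : ℝ × ℝ × ℝ → ℝ := fun z => c * f z.1 z.2.1 z.2.2 F + ε * z.1
  have hφneg : φ (t, r, w) < 0 := by
    simp only [φ]; nlinarith
  have hne : f t r w F ≠ 0 := fun h => by simp [h] at hneg
  have hmem : ((t, r, w) : ℝ × ℝ × ℝ) ∈ Icc 0 t ×ˢ (Icc δ K ×ˢ Icc (-K) K) := by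
    obtain ⟨h1, h2, h3, h4⟩ := hsupp t r w ht le_rfl hr hne
    exact ⟨⟨ht, le_rfl⟩, ⟨h1.le, h2.le⟩, h3.le, h4.le⟩
  have hcont : ContinuousOn φ (Icc 0 t ×ˢ (Icc δ K ×ˢ Icc (-K) K)) := by
    refine (continuousOn_const.mul (hsol.f_cont.comp
      (f := fun z : ℝ × ℝ × ℝ => (z.1, z.2.1, z.2.2, F)) (by fun_prop) ?_)).add (by fun_prop)
    rintro ⟨a, b, d⟩ ⟨h1, h2, -⟩
    exact ⟨⟨h1.1, h1.2.trans_lt htT⟩, lt_of_lt_of_le hδ h2.1, trivial, hF.le⟩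
  obtain ⟨⟨t₀, r₀, w₀⟩, ⟨ht₀, hr₀, hw₀⟩, hmin⟩ :=
    (isCompact_Icc.prod (isCompact_Icc.prod isCompact_Icc)).exists_isMinOn ⟨_, hmem⟩ hcont
  simp only at ht₀ hr₀ hw₀
  have hmin' : ∀ a b d, 0 ≤ a → a ≤ t → δ ≤ b → b ≤ K → -K ≤ d → d ≤ K →
      c * f t₀ r₀ w₀ F + ε * t₀ ≤ c * f a b d F + ε * a := fun a b d h1 h2 h3 h4 h5 h6 =>
    hmin (show ((a, b, d) : ℝ × ℝ × ℝ) ∈ _ from ⟨⟨h1, h2⟩, ⟨h3, h4⟩, h5, h6⟩)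
  have hr₀' : 0 < r₀ := hδ.trans_le hr₀.1
  have hfneg : c * f t₀ r₀ w₀ F < 0 := by
    have h1 : φ (t₀, r₀, w₀) ≤ φ (t, r, w) := hmin hmem
    have h2 := mul_nonneg hε.le ht₀.1
    simp only [φ] at h1 hφneg
    linarith
  have hc : c ≠ 0 := fun h => by simp [h] at hfneg
  have hne₀ : f t₀ r₀ w₀ F ≠ 0 := fun h => by simp [h] at hfneg
  obtain ⟨h1, h2, h3, h4⟩ := hsupp t₀ r₀ w₀ ht₀.1 ht₀.2 hr₀' hne₀
  have ht₀pos : 0 < t₀ := by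
    rcases ht₀.1.eq_or_lt with h | h
    · have := h0 r₀ w₀ hr₀'
      rw [h] at this
      linarith
    · exact h
  have hrz : deriv (fun η => f t₀ η w₀ F) r₀ = 0 := by
    have hloc : IsLocalMin (fun η => c * f t₀ η w₀ F) r₀ := by
      filter_upwards [Icc_mem_nhds h1 h2] with η hη
      linarith [hmin' t₀ η w₀ ht₀.1 ht₀.2 hη.1 hη.2 hw₀.1 hw₀.2]
    have := hloc.deriv_eq_zero
    rw [deriv_const_mul_field] at this
    exact (mul_eq_zero.1 this).resolve_left hc
  have hwz : deriv (fun u => f t₀ r₀ u F) w₀ = 0 := by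
    have hloc : IsLocalMin (fun u => c * f t₀ r₀ u F) w₀ := by
      filter_upwards [Icc_mem_nhds h3 h4] with η hη
      linarith [hmin' t₀ r₀ η ht₀.1 ht₀.2 hr₀.1 hr₀.2 hη.1 hη.2]
    have := hloc.deriv_eq_zero
    rw [deriv_const_mul_field] at this
    exact (mul_eq_zero.1 this).resolve_left hc
  have ht₀T := ht₀.2.trans_lt htT
  have htz : deriv (fun τ => f τ r₀ w₀ F) t₀ = 0 := by
    have := hsol.vlasov t₀ r₀ w₀ F ht₀.1 ht₀T hr₀' hF
    rw [hrz, hwz, derivWithin_Ici_eq_deriv _ ht₀pos] at this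
    linarith
  have hdiff : HasDerivAt (fun τ => f τ r₀ w₀ F) 0 t₀ := by
    rw [← htz]
    refine DifferentiableAt.hasDerivAt ?_
    exact (hsol.differentiableAt_f ht₀pos ht₀T hr₀' hF).comp
      (f := fun τ : ℝ => (τ, r₀, w₀, F)) t₀ (by fun_prop)
  have hd : HasDerivAt (fun τ => c * f τ r₀ w₀ F + ε * τ) ε t₀ := by
    exact ((hdiff.const_mul c).add ((hasDerivAt_id t₀).const_mul ε)).congr_deriv (by simp)
  have hslope : ∀ᶠ τ in 𝓝[<] t₀, 0 < slope (fun τ => c * f τ r₀ w₀ F + ε * τ) t₀ τ :=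
    (hd.tendsto_slope.mono_left (nhdsWithin_mono _ fun x hx => ne_of_lt hx)).eventually
      (lt_mem_nhds hε)
  obtain ⟨τ, hτ, hτ0, hτt⟩ := (hslope.and ((eventually_nhdsWithin_of_eventually_nhds
    (lt_mem_nhds ht₀pos)).and eventually_mem_nhdsWithin)).exists
  have hτt : τ < t₀ := hτt
  have hτ0 : 0 < τ := hτ0
  have hcmp := hmin' τ r₀ w₀ hτ0.le (hτt.le.trans ht₀.2) hr₀.1 hr₀.2 hw₀.1 hw₀.2
  rw [slope_def_field] at hτ
  have := div_nonpos_of_nonneg_of_nonpos (sub_nonneg.2 hcmp) (sub_nonpos.2 hτt.le)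
  linarith

theorem IsRegularSolution.f_nonneg (hf₀ : IsCutoffData Rm Fm f₀)
    (hsol : IsRegularSolution T f₀ f lam mu) {t r w F : ℝ} (ht : 0 ≤ t)
    (htT : t < T) (hr : 0 < r) (hF : 0 < F) : 0 ≤ f t r w F := by
  have := hsol.nonneg_of_initial (c := 1) (w := w) hF (fun r w hr => by
    rw [hsol.initial r w F hr hF.le, one_mul]
    exact hf₀.nonneg r w F hr.le hF.le) ht htT hr
  simpa using this

theorem IsRegularSolution.f_eq_zero_of_le (hf₀ : IsCutoffData Rm Fm f₀)
    (hsol : IsRegularSolution T f₀ f lam mu) {t r w F : ℝ} (ht : 0 ≤ t)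
    (htT : t < T) (hr : 0 < r) (hF : 0 < F) (hFm : F ≤ Fm) : f t r w F = 0 := by
  have := hsol.nonneg_of_initial (c := -1) (w := w) hF (fun r w hr => by
    rw [hsol.initial r w F hr hF.le, hf₀.angular_cutoff r w F hr.le hF.le hFm, mul_zero]) ht htT hr
  linarith [hsol.f_nonneg hf₀ (w := w) ht htT hr hF]

theorem IsCharacteristic.continuousOn_R {r w F : ℝ} {R W : ℝ → ℝ}
    (hchar : IsCharacteristic T lam mu r w F R W) : ContinuousOn R (Ico 0 T) := fun s hs =>
  (hchar.deriv_R s hs).continuousWithinAt.mono Ico_subset_Ici_self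

theorem IsCharacteristic.continuousOn_W {r w F : ℝ} {R W : ℝ → ℝ}
    (hchar : IsCharacteristic T lam mu r w F R W) : ContinuousOn W (Ico 0 T) := fun s hs =>
  (hchar.deriv_W s hs).continuousWithinAt.mono Ico_subset_Ici_self

/-- The distribution function is constant along characteristics. -/
theorem IsCharacteristic.f_eq {r w F : ℝ} {R W : ℝ → ℝ}
    (hsol : IsRegularSolution T f₀ f lam mu) (hchar : IsCharacteristic T lam mu r w F R W)
    (hF : 0 < F) {s : ℝ} (hs : s ∈ Ico 0 T) : f s (R s) (W s) F = f₀ r w F := by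
  have h00 : (0 : ℝ) ∈ Ico 0 T := ⟨le_rfl, hs.1.trans_lt hs.2⟩
  have hstart : f 0 (R 0) (W 0) F = f₀ r w F := by
    rw [hsol.initial _ _ _ (hchar.pos 0 h00) hF.le, hchar.start_R, hchar.start_W]
  rcases hs.1.eq_or_lt with h | hpos
  · rw [← h, hstart]
  have hcont : ContinuousOn (fun s => f s (R s) (W s) F) (Icc 0 s) := by
    refine ContinuousOn.mono ?_ (Icc_subset_Ico_right hs.2)
    refine hsol.f_cont.comp (f := fun s : ℝ => (s, R s, W s, F)) ?_ fun σ hσ =>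
      ⟨hσ, hchar.pos σ hσ, trivial, hF.le⟩
    exact continuousOn_id.prodMk (hchar.continuousOn_R.prodMk
      (hchar.continuousOn_W.prodMk continuousOn_const))
  have hderiv : ∀ σ ∈ Ioo 0 s, HasDerivAt (fun s => f s (R s) (W s) F) 0 σ := by
    intro σ hσ
    have hσT : σ ∈ Ico 0 T := ⟨hσ.1.le, hσ.2.trans hs.2⟩
    have hRpos := hchar.pos σ hσT
    have hR := (hchar.deriv_R σ hσT).hasDerivAt (Ici_mem_nhds hσ.1)
    have hW := (hchar.deriv_W σ hσT).hasDerivAt (Ici_mem_nhds hσ.1)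
    have hD := (hsol.differentiableAt_f (w := W σ) hσ.1 hσT.2 hRpos hF).hasFDerivAt
    set D := fderiv ℝ (fun z : ℝ × ℝ × ℝ × ℝ => f z.1 z.2.1 z.2.2.1 z.2.2.2)
      (σ, R σ, W σ, F) with hDdef
    have ht : HasDerivAt (fun τ => f τ (R σ) (W σ) F) (D (1, 0, 0, 0)) σ :=
      hD.comp_hasDerivAt (f := fun τ : ℝ => (τ, R σ, W σ, F)) σ
        ((hasDerivAt_id σ).prodMk (hasDerivAt_const σ _))
    have hr : HasDerivAt (fun η => f σ η (W σ) F) (D (0, 1, 0, 0)) (R σ) :=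
      hD.comp_hasDerivAt (f := fun τ : ℝ => (σ, τ, W σ, F)) (R σ)
        ((hasDerivAt_const _ _).prodMk ((hasDerivAt_id (R σ)).prodMk (hasDerivAt_const _ _)))
    have hw : HasDerivAt (fun u => f σ (R σ) u F) (D (0, 0, 1, 0)) (W σ) :=
      hD.comp_hasDerivAt (f := fun τ : ℝ => (σ, R σ, τ, F)) (W σ)
        ((hasDerivAt_const _ _).prodMk ((hasDerivAt_const _ _).prodMk
          ((hasDerivAt_id (W σ)).prodMk (hasDerivAt_const _ _))))
    have hV := hsol.vlasov σ (R σ) (W σ) F hσ.1.le hσT.2 hRpos hF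
    rw [derivWithin_Ici_eq_deriv _ hσ.1, ht.deriv, hr.deriv, hw.deriv] at hV
    have hcomp := hD.comp_hasDerivAt (f := fun τ : ℝ => (τ, R τ, W τ, F)) σ
      ((hasDerivAt_id σ).prodMk (hR.prodMk (hW.prodMk (hasDerivAt_const _ _))))
    refine hcomp.congr_deriv (Eq.trans ?_ hV)
    have hsplit : ∀ a b : ℝ, ((1, a, b, 0) : ℝ × ℝ × ℝ × ℝ)
        = (1, 0, 0, 0) + (a • (0, 1, 0, 0) + b • (0, 0, 1, 0)) := by
      intro a b; simp
    rw [hsplit, map_add, map_add, map_smul, map_smul, smul_eq_mul, smul_eq_mul]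
    ring
  obtain ⟨σ, hσ, heq⟩ := exists_deriv_eq_slope (fun s => f s (R s) (W s) F) hpos hcont
    fun σ hσ => (hderiv σ hσ).differentiableAt.differentiableWithinAt
  rw [(hderiv σ hσ).deriv, eq_comm, div_eq_zero_iff] at heq
  rcases heq with heq | heq
  · linarith
  · linarith

/-- The domain of the momentum variables `(w, F)`. -/
abbrev momentumSpace : Set (ℝ × ℝ) := univ ×ˢ Ioi 0

theorem isOpen_momentumSpace : IsOpen momentumSpace := isOpen_univ.prod isOpen_Ioi

theorem IsRegularSolution.continuousOn_momentum (hsol : IsRegularSolution T f₀ f lam mu)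
    {t r : ℝ} (ht : 0 ≤ t) (htT : t < T) (hr : 0 < r) :
    ContinuousOn (fun z : ℝ × ℝ => f t r z.1 z.2) momentumSpace :=
  hsol.f_cont.comp (f := fun z : ℝ × ℝ => (t, r, z.1, z.2)) (by fun_prop) fun _ hz =>
    ⟨⟨ht, htT⟩, hr, trivial, (le_of_lt hz.2 : (0 : ℝ) ≤ _)⟩

theorem IsRegularSolution.integrableOn_moment (hf₀ : IsCutoffData Rm Fm f₀) (hFm : 0 < Fm)
    (hsol : IsRegularSolution T f₀ f lam mu) {t r : ℝ} (ht : 0 ≤ t) (htT : t < T) (hr : 0 < r)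
    {k : ℝ × ℝ → ℝ} (hk : ContinuousOn k momentumSpace) :
    IntegrableOn (fun z : ℝ × ℝ => k z * f t r z.1 z.2) momentumSpace := by
  obtain ⟨K, hK⟩ := hsol.f_support t htT
  have hsub : Icc (-|K|) |K| ×ˢ Icc Fm (K ^ 2 * r ^ 2) ⊆ momentumSpace := fun z hz =>
    ⟨trivial, hFm.trans_le hz.2.1⟩
  have hbox : IntegrableOn (fun z : ℝ × ℝ => k z * f t r z.1 z.2)
      (Icc (-|K|) |K| ×ˢ Icc Fm (K ^ 2 * r ^ 2)) :=
    ((hk.mul (hsol.continuousOn_momentum ht htT hr)).mono hsub).integrableOn_compact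
      (isCompact_Icc.prod isCompact_Icc)
  refine hbox.of_forall_sdiff_eq_zero isOpen_momentumSpace.measurableSet fun z hz => ?_
  by_contra hne
  have hne' : f t r z.1 z.2 ≠ 0 := right_ne_zero_of_mul hne
  have hzF : 0 < z.2 := hz.1.2
  obtain ⟨-, h2⟩ := hK t r z.1 z.2 ht le_rfl hr hzF.le hne'
  have h3 : 0 ≤ z.2 / r ^ 2 := by positivity
  refine hz.2 ⟨abs_le.1 (sq_le_sq.1 (by linarith)), ?_, ?_⟩
  · by_contra hlt
    exact hne' (hsol.f_eq_zero_of_le hf₀ ht htT hr hzF (not_le.1 hlt).le)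
  · rw [← div_le_iff₀ (by positivity)]
    nlinarith [sq_nonneg z.1]

theorem IsRegularSolution.iterated_integral_eq (hf₀ : IsCutoffData Rm Fm f₀) (hFm : 0 < Fm)
    (hsol : IsRegularSolution T f₀ f lam mu) {t r : ℝ} (ht : 0 ≤ t) (htT : t < T) (hr : 0 < r)
    {k : ℝ × ℝ → ℝ} (hk : ContinuousOn k momentumSpace) :
    ∫ w : ℝ, ∫ F in Ioi (0 : ℝ), k (w, F) * f t r w F
      = ∫ z in momentumSpace, k z * f t r z.1 z.2 := by
  have := setIntegral_prod (μ := volume) (ν := volume) (s := univ) (t := Ioi (0 : ℝ))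
    (fun z : ℝ × ℝ => k z * f t r z.1 z.2) (hsol.integrableOn_moment hf₀ hFm ht htT hr hk)
  rw [← Measure.volume_eq_prod] at this
  rw [this]
  simp

theorem continuous_energy {r : ℝ} : Continuous (fun z : ℝ × ℝ => energy r z.1 z.2) := by
  unfold energy
  fun_prop

theorem continuousOn_div_energy {r : ℝ} {k : ℝ × ℝ → ℝ} (hk : Continuous k) :
    ContinuousOn (fun z : ℝ × ℝ => k z / energy r z.1 z.2) momentumSpace :=
  hk.continuousOn.div continuous_energy.continuousOn fun z hz =>
    (energy_pos (le_of_lt (hz.2 : (0 : ℝ) < z.2))).ne'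

/-- If the outgoing current vanishes, there are no outgoing particles. -/
theorem IsRegularSolution.f_eq_zero_of_pos (hf₀ : IsCutoffData Rm Fm f₀) (hFm : 0 < Fm)
    (hsol : IsRegularSolution T f₀ f lam mu) {t r w F : ℝ} (ht : 0 ≤ t) (htT : t < T) (hr : 0 < r)
    (hj : curPlus f t r = 0) (hw : 0 < w) (hF : 0 < F) : f t r w F = 0 := by
  have hint := hsol.integrableOn_moment hf₀ hFm ht htT hr (k := fun z => z.1) (by fun_prop)
  have hsub : (Ioi 0 ×ˢ Ioi 0 : Set (ℝ × ℝ)) ⊆ momentumSpace := fun z hz => ⟨trivial, hz.2⟩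
  have hint' := hint.mono_set hsub
  have hopen : IsOpen (Ioi 0 ×ˢ Ioi 0 : Set (ℝ × ℝ)) := isOpen_Ioi.prod isOpen_Ioi
  have h1 := setIntegral_prod (μ := volume) (ν := volume) (s := Ioi (0 : ℝ)) (t := Ioi (0 : ℝ))
    (fun z : ℝ × ℝ => z.1 * f t r z.1 z.2) hint'
  rw [← Measure.volume_eq_prod] at h1
  have h2 : ∫ z in (Ioi 0 ×ˢ Ioi 0 : Set (ℝ × ℝ)), z.1 * f t r z.1 z.2 = 0 := by
    rw [h1]
    have : Real.pi / r ^ 2 ≠ 0 := by positivity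
    exact (mul_eq_zero.1 hj).resolve_left this
  have hnn : 0 ≤ᵐ[volume.restrict (Ioi 0 ×ˢ Ioi 0 : Set (ℝ × ℝ))]
      fun z : ℝ × ℝ => z.1 * f t r z.1 z.2 := by
    filter_upwards [ae_restrict_mem hopen.measurableSet] with z hz
    exact mul_nonneg (le_of_lt hz.1) (hsol.f_nonneg hf₀ ht htT hr hz.2)
  have h3 := (setIntegral_eq_zero_iff_of_nonneg_ae hnn hint').1 h2
  have h4 := Measure.eqOn_open_of_ae_eq h3 hopen
    ((continuousOn_fst.mul (hsol.continuousOn_momentum ht htT hr)).mono hsub) continuousOn_const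
  have h5 : w * f t r w F = 0 := h4 (show ((w, F) : ℝ × ℝ) ∈ _ from ⟨hw, hF⟩)
  exact (mul_eq_zero.1 h5).resolve_left hw.ne'

theorem IsRegularSolution.rho_eq (hf₀ : IsCutoffData Rm Fm f₀) (hFm : 0 < Fm)
    (hsol : IsRegularSolution T f₀ f lam mu) {t r : ℝ} (ht : 0 ≤ t) (htT : t < T) (hr : 0 < r) :
    rho f t r = Real.pi / r ^ 2 * ∫ z in momentumSpace, energy r z.1 z.2 * f t r z.1 z.2 := by
  rw [rho, ← hsol.iterated_integral_eq hf₀ hFm ht htT hr continuous_energy.continuousOn]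

theorem IsRegularSolution.pres_eq (hf₀ : IsCutoffData Rm Fm f₀) (hFm : 0 < Fm)
    (hsol : IsRegularSolution T f₀ f lam mu) {t r : ℝ} (ht : 0 ≤ t) (htT : t < T) (hr : 0 < r) :
    pres f t r = Real.pi / r ^ 2 *
      ∫ z in momentumSpace, z.1 ^ 2 / energy r z.1 z.2 * f t r z.1 z.2 := by
  rw [pres, ← hsol.iterated_integral_eq hf₀ hFm ht htT hr
    (continuousOn_div_energy (k := fun z => z.1 ^ 2) (by fun_prop))]

theorem IsRegularSolution.cur_eq (hf₀ : IsCutoffData Rm Fm f₀) (hFm : 0 < Fm)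
    (hsol : IsRegularSolution T f₀ f lam mu) {t r : ℝ} (ht : 0 ≤ t) (htT : t < T) (hr : 0 < r) :
    cur f t r = Real.pi / r ^ 2 * ∫ z in momentumSpace, z.1 * f t r z.1 z.2 := by
  rw [cur, ← hsol.iterated_integral_eq hf₀ hFm ht htT hr (k := fun z => z.1) (by fun_prop)]

theorem IsRegularSolution.tang_eq (hf₀ : IsCutoffData Rm Fm f₀) (hFm : 0 < Fm)
    (hsol : IsRegularSolution T f₀ f lam mu) {t r : ℝ} (ht : 0 ≤ t) (htT : t < T) (hr : 0 < r) :
    tang f t r = Real.pi / r ^ 4 *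
      ∫ z in momentumSpace, z.2 / energy r z.1 z.2 * f t r z.1 z.2 := by
  rw [tang, ← hsol.iterated_integral_eq hf₀ hFm ht htT hr
    (continuousOn_div_energy (k := fun z => z.2) (by fun_prop))]

theorem IsRegularSolution.rho_nonneg (hf₀ : IsCutoffData Rm Fm f₀) (hFm : 0 < Fm)
    (hsol : IsRegularSolution T f₀ f lam mu) {t r : ℝ} (ht : 0 ≤ t) (htT : t < T) (hr : 0 < r) :
    0 ≤ rho f t r := by
  rw [hsol.rho_eq hf₀ hFm ht htT hr]
  refine mul_nonneg (by positivity) (setIntegral_nonneg isOpen_momentumSpace.measurableSet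
    fun z hz => mul_nonneg (Real.sqrt_nonneg _) (hsol.f_nonneg hf₀ ht htT hr hz.2))

theorem IsRegularSolution.pres_nonneg (hf₀ : IsCutoffData Rm Fm f₀) (hFm : 0 < Fm)
    (hsol : IsRegularSolution T f₀ f lam mu) {t r : ℝ} (ht : 0 ≤ t) (htT : t < T) (hr : 0 < r) :
    0 ≤ pres f t r := by
  rw [hsol.pres_eq hf₀ hFm ht htT hr]
  refine mul_nonneg (by positivity) (setIntegral_nonneg isOpen_momentumSpace.measurableSet
    fun z hz => mul_nonneg (div_nonneg (sq_nonneg _) (Real.sqrt_nonneg _))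
      (hsol.f_nonneg hf₀ ht htT hr hz.2))

theorem IsRegularSolution.cur_nonpos (hf₀ : IsCutoffData Rm Fm f₀) (hFm : 0 < Fm)
    (hsol : IsRegularSolution T f₀ f lam mu) {t r : ℝ} (ht : 0 ≤ t) (htT : t < T) (hr : 0 < r)
    (hj : curPlus f t r = 0) : cur f t r ≤ 0 := by
  rw [hsol.cur_eq hf₀ hFm ht htT hr]
  refine mul_nonpos_of_nonneg_of_nonpos (by positivity)
    (setIntegral_nonpos isOpen_momentumSpace.measurableSet fun z hz => ?_)
  rcases le_or_gt z.1 0 with h | h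
  · exact mul_nonpos_of_nonpos_of_nonneg h (hsol.f_nonneg hf₀ ht htT hr hz.2)
  · rw [hsol.f_eq_zero_of_pos hf₀ hFm ht htT hr hj h hz.2, mul_zero]

theorem ingoing_integrand_le {r w F θ : ℝ} (hr : 0 < r) (hFm : 0 < Fm) (hF : Fm ≤ F) (hw : w ≤ 0)
    (hθ : θ ≤ 1) :
    w ^ 2 / energy r w F - 1 / r ^ 2 * (F / energy r w F)
      + θ * (energy r w F + w ^ 2 / energy r w F) + (2 * θ + 1) * w
      - r ^ 2 / Fm * energy r w F ≤ 0 := by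
  have hF0 : 0 ≤ F := hFm.le.trans hF
  have hE := energy_pos (r := r) (w := w) hF0
  have hE2 := energy_sq (r := r) (w := w) hF0
  have hwE := abs_le_energy (r := r) (w := w) hF0
  set E := energy r w F
  have h1 : Fm / r ^ 2 ≤ E ^ 2 := by
    have : Fm / r ^ 2 ≤ F / r ^ 2 := by gcongr
    nlinarith [sq_nonneg w]
  have h2 : 1 ≤ r ^ 2 / Fm * E ^ 2 := by
    calc (1 : ℝ) = r ^ 2 / Fm * (Fm / r ^ 2) := by field_simp
      _ ≤ _ := by gcongr
  have h3 : 0 ≤ w + E := by linarith [neg_abs_le w]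
  have h4 : 1 / r ^ 2 * F = E ^ 2 - 1 - w ^ 2 := by
    rw [hE2]; ring
  have h5 : w ^ 2 / E - 1 / r ^ 2 * (F / E) + θ * (E + w ^ 2 / E) + (2 * θ + 1) * w
      - r ^ 2 / Fm * E = (w ^ 2 - 1 / r ^ 2 * F + θ * (E + w) ^ 2 + w * E
        - r ^ 2 / Fm * E ^ 2) / E := by
    field_simp
    ring
  rw [h5, h4]
  refine div_nonpos_of_nonpos_of_nonneg ?_ hE.le
  nlinarith [mul_nonneg (sub_nonneg.2 hθ) (sq_nonneg (E + w)), mul_nonneg (neg_nonneg.2 hw) h3]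

theorem integral_matter_combination {α : Type*} [MeasurableSpace α] {ν : Measure α}
    {u₁ u₂ u₃ u₄ u₅ u₆ : α → ℝ} {a b c d : ℝ} (h₁ : Integrable u₁ ν) (h₂ : Integrable u₂ ν)
    (h₃ : Integrable u₃ ν) (h₄ : Integrable u₄ ν) (h₅ : Integrable u₅ ν) (h₆ : Integrable u₆ ν) :
    ∫ z, (u₁ z - a * u₂ z + b * (u₃ z + u₄ z) + c * u₅ z - d * u₆ z) ∂ν
      = ∫ z, u₁ z ∂ν - a * ∫ z, u₂ z ∂ν + b * (∫ z, u₃ z ∂ν + ∫ z, u₄ z ∂ν) + c * ∫ z, u₅ z ∂ν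
        - d * ∫ z, u₆ z ∂ν := by
  have k₂ := h₂.const_mul a
  have k₁ : Integrable (fun z => u₁ z - a * u₂ z) ν := h₁.sub k₂
  have k₃ : Integrable (fun z => u₃ z + u₄ z) ν := h₃.add h₄
  have k₄ := k₃.const_mul b
  have k₅ := h₅.const_mul c
  have k₆ := h₆.const_mul d
  have k₇ : Integrable (fun z => u₁ z - a * u₂ z + b * (u₃ z + u₄ z)) ν := k₁.add k₄
  have k₈ : Integrable (fun z => u₁ z - a * u₂ z + b * (u₃ z + u₄ z) + c * u₅ z) ν := k₇.add k₅
  rw [integral_sub k₈ k₆, integral_add k₇ k₅, integral_add k₁ k₄, integral_sub h₁ k₂,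
    integral_const_mul, integral_const_mul, integral_const_mul, integral_const_mul,
    integral_add h₃ h₄]

/-- The combination of matter terms produced by the field equations is controlled by `r² ρ` when all
matter is ingoing and has angular momentum at least `Fm`. -/
theorem IsRegularSolution.matter_le (hf₀ : IsCutoffData Rm Fm f₀) (hFm : 0 < Fm)
    (hsol : IsRegularSolution T f₀ f lam mu) {t r θ : ℝ} (ht : 0 ≤ t) (htT : t < T) (hr : 0 < r)
    (hj : curPlus f t r = 0) (hθ : θ ≤ 1) :
    pres f t r - tang f t r + θ * (rho f t r + pres f t r) + (2 * θ + 1) * cur f t r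
      ≤ r ^ 2 / Fm * rho f t r := by
  have iE := hsol.integrableOn_moment hf₀ hFm ht htT hr (continuous_energy (r := r)).continuousOn
  have iP := hsol.integrableOn_moment hf₀ hFm ht htT hr
    (continuousOn_div_energy (r := r) (k := fun z => z.1 ^ 2) (by fun_prop))
  have iQ := hsol.integrableOn_moment hf₀ hFm ht htT hr
    (continuousOn_div_energy (r := r) (k := fun z => z.2) (by fun_prop))
  have iJ := hsol.integrableOn_moment hf₀ hFm ht htT hr (k := fun z => z.1) (by fun_prop)
  have hle : ∫ z in momentumSpace,
      (z.1 ^ 2 / energy r z.1 z.2 * f t r z.1 z.2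
        - 1 / r ^ 2 * (z.2 / energy r z.1 z.2 * f t r z.1 z.2)
        + θ * (energy r z.1 z.2 * f t r z.1 z.2 + z.1 ^ 2 / energy r z.1 z.2 * f t r z.1 z.2)
        + (2 * θ + 1) * (z.1 * f t r z.1 z.2)
        - r ^ 2 / Fm * (energy r z.1 z.2 * f t r z.1 z.2)) ≤ 0 := by
    refine setIntegral_nonpos isOpen_momentumSpace.measurableSet fun z hz => ?_
    rcases le_or_gt z.2 Fm with h | h
    · rw [hsol.f_eq_zero_of_le hf₀ ht htT hr hz.2 h]; simp
    rcases le_or_gt z.1 0 with h' | h'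
    · have h1 := mul_nonpos_of_nonpos_of_nonneg
        (ingoing_integrand_le hr hFm h.le h' hθ) (hsol.f_nonneg hf₀ (w := z.1) ht htT hr hz.2)
      linarith
    · rw [hsol.f_eq_zero_of_pos hf₀ hFm ht htT hr hj h' hz.2]; simp
  rw [integral_matter_combination iP iQ iE iP iJ iE] at hle
  rw [hsol.rho_eq hf₀ hFm ht htT hr, hsol.pres_eq hf₀ hFm ht htT hr,
    hsol.cur_eq hf₀ hFm ht htT hr, hsol.tang_eq hf₀ hFm ht htT hr]
  have hpos : 0 ≤ Real.pi / r ^ 2 := by positivity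
  have hr4 : Real.pi / r ^ 4 = Real.pi / r ^ 2 * (1 / r ^ 2) := by field_simp
  rw [hr4]
  linarith [mul_nonpos_of_nonneg_of_nonpos hpos hle]

/-- Outside the support of `f` the matter terms vanish. -/
theorem matter_eq_zero {t r : ℝ} (h : ∀ w F, 0 < F → f t r w F = 0) :
    rho f t r = 0 ∧ pres f t r = 0 ∧ cur f t r = 0 := by
  have hz : ∀ k : ℝ → ℝ → ℝ, ∫ w : ℝ, ∫ F in Ioi (0 : ℝ), k w F * f t r w F = 0 := fun k => by
    have : ∀ w, ∫ F in Ioi (0 : ℝ), k w F * f t r w F = 0 := fun w => by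
      refine setIntegral_eq_zero_of_forall_eq_zero fun F hF => ?_
      rw [h w F hF, mul_zero]
    simp [this]
  refine ⟨?_, ?_, ?_⟩
  · rw [rho, hz fun w F => energy r w F, mul_zero]
  · rw [pres, hz fun w F => w ^ 2 / energy r w F, mul_zero]
  · rw [cur, hz fun w _ => w, mul_zero]

/-- `C¹` regularity on the interior of the time-radius domain. -/
abbrev IsC1Inside (T : ℝ) (g : ℝ → ℝ → ℝ) : Prop :=
  ContDiffOn ℝ 1 (fun z : ℝ × ℝ => g z.1 z.2) (Ioo 0 T ×ˢ Ioi 0)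

theorem interior_subset_domain : (Ioo 0 T ×ˢ Ioi 0 : Set (ℝ × ℝ)) ⊆ Ico 0 T ×ˢ Ici 0 :=
  prod_mono Ioo_subset_Ico_self Ioi_subset_Ici_self

theorem IsRegularSolution.lam_inside (hsol : IsRegularSolution T f₀ f lam mu) :
    IsC1Inside T lam := hsol.lam_C1.mono interior_subset_domain

theorem IsRegularSolution.mu_inside (hsol : IsRegularSolution T f₀ f lam mu) :
    IsC1Inside T mu := hsol.mu_C1.mono interior_subset_domain

theorem IsRegularSolution.dr_mu_inside (hsol : IsRegularSolution T f₀ f lam mu) :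
    IsC1Inside T (dr mu) := hsol.mu_r_C1.mono interior_subset_domain

theorem IsRegularSolution.dt_lam_inside (hsol : IsRegularSolution T f₀ f lam mu) :
    IsC1Inside T (dt lam) := hsol.lam_t_C1.mono interior_subset_domain

theorem IsC1Inside.hasDerivAt_r {g : ℝ → ℝ → ℝ} (hg : IsC1Inside T g) {t r : ℝ}
    (ht : t ∈ Ioo 0 T) (hr : 0 < r) : HasDerivAt (fun η => g t η) (dr g t r) r := by
  rw [dr, derivWithin_Ici_eq_deriv _ hr]
  exact (hasDerivAt_snd_of_contDiffOn isOpen_Ioo hg ht hr).differentiableAt.hasDerivAt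

theorem IsC1Inside.hasDerivAt_t {g : ℝ → ℝ → ℝ} (hg : IsC1Inside T g) {t r : ℝ}
    (ht : t ∈ Ioo 0 T) (hr : 0 < r) : HasDerivAt (fun τ => g τ r) (dt g t r) t := by
  rw [dt, derivWithin_Ici_eq_deriv _ ht.1]
  exact (hasDerivAt_fst_of_contDiffOn isOpen_Ioo hg ht hr).differentiableAt.hasDerivAt

theorem exp_neg_two_mul (a : ℝ) : Real.exp (-2 * a) = (Real.exp (2 * a))⁻¹ := by
  rw [← Real.exp_neg]; ring_nf

/-- The mass function expressed through the metric coefficient `λ`. -/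
def metricMass (lam : ℝ → ℝ → ℝ) (t r : ℝ) : ℝ := r * (1 - Real.exp (-2 * lam t r)) / 2

theorem IsRegularSolution.metricMass_inside (hsol : IsRegularSolution T f₀ f lam mu) :
    IsC1Inside T (metricMass lam) := by
  have h := hsol.lam_inside
  unfold IsC1Inside metricMass
  fun_prop

theorem IsRegularSolution.hasDerivAt_metricMass (hsol : IsRegularSolution T f₀ f lam mu) {t r : ℝ}
    (ht : t ∈ Ioo 0 T) (hr : 0 < r) :
    HasDerivAt (metricMass lam t) (4 * Real.pi * r ^ 2 * rho f t r) r := by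
  have h1 := hsol.lam_inside.hasDerivAt_r ht hr
  have h2 := (((hasDerivAt_id r).mul ((h1.const_mul (-2)).exp.const_sub 1)).div_const 2)
  refine h2.congr_deriv ?_
  have := hsol.einstein₁ t r ht.1.le ht.2 hr
  simp only [id]
  linarith

theorem IsRegularSolution.mass_eq (hsol : IsRegularSolution T f₀ f lam mu) {t r : ℝ}
    (ht : t ∈ Ioo 0 T) (hr : 0 < r) : mass f t r = metricMass lam t r := by
  have hmaps : MapsTo (fun η : ℝ => (t, η)) (Icc 0 r) (Ico 0 T ×ˢ Ici 0) := fun η hη =>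
    ⟨Ioo_subset_Ico_self ht, hη.1⟩
  have hlam : ContinuousOn (fun η => lam t η) (Icc 0 r) :=
    hsol.lam_C1.continuousOn.comp (f := fun η : ℝ => (t, η)) (by fun_prop) hmaps
  have hlamr : ContinuousOn (fun η => dr lam t η) (Icc 0 r) :=
    hsol.lam_r_C1.continuousOn.comp (f := fun η : ℝ => (t, η)) (by fun_prop) hmaps
  have hcont : ContinuousOn (metricMass lam t) (Icc 0 r) := by
    unfold metricMass
    fun_prop
  let D : ℝ → ℝ := fun η => (Real.exp (-2 * lam t η) * (2 * η * dr lam t η - 1) + 1) / 2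
  have hD : ContinuousOn D (Icc 0 r) := by
    simp only [D]
    fun_prop
  have hDeq : ∀ η, 0 < η → D η = 4 * Real.pi * (η ^ 2 * rho f t η) := fun η hη => by
    have := hsol.einstein₁ t η ht.1.le ht.2 hη
    simp only [D]
    linarith
  have hFTC := intervalIntegral.integral_eq_sub_of_hasDerivAt_of_le hr.le hcont
    (f' := D) (fun η hη => (hsol.hasDerivAt_metricMass ht hη.1).congr_deriv (by
      rw [hDeq η hη.1]; ring)) (hD.intervalIntegrable_of_Icc hr.le)
  have hcongr : ∫ η in (0 : ℝ)..r, D η = ∫ η in (0 : ℝ)..r, 4 * Real.pi * (η ^ 2 * rho f t η) := by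
    refine intervalIntegral.integral_congr_ae (Eventually.of_forall fun η hη => ?_)
    rw [uIoc_of_le hr.le] at hη
    exact hDeq η hη.1
  rw [mass, ← intervalIntegral.integral_const_mul, ← hcongr, hFTC]
  simp [metricMass]

theorem IsRegularSolution.metricMass_nonneg (hf₀ : IsCutoffData Rm Fm f₀) (hFm : 0 < Fm)
    (hsol : IsRegularSolution T f₀ f lam mu) {t r : ℝ} (ht : t ∈ Ioo 0 T) (hr : 0 < r) :
    0 ≤ metricMass lam t r := by
  rw [← hsol.mass_eq ht hr, mass]
  refine mul_nonneg (by positivity) ?_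
  rw [intervalIntegral.integral_of_le hr.le]
  exact setIntegral_nonneg measurableSet_Ioc fun η hη =>
    mul_nonneg (sq_nonneg _) (hsol.rho_nonneg hf₀ hFm ht.1.le ht.2 hη.1)

theorem IsRegularSolution.one_le_exp (hf₀ : IsCutoffData Rm Fm f₀) (hFm : 0 < Fm)
    (hsol : IsRegularSolution T f₀ f lam mu) {t r : ℝ} (ht : t ∈ Ioo 0 T) (hr : 0 < r) :
    1 ≤ Real.exp (2 * lam t r) := by
  have h := hsol.metricMass_nonneg hf₀ hFm ht hr
  have h1 : 0 ≤ 1 - Real.exp (-2 * lam t r) := by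
    by_contra hneg
    have := mul_neg_of_pos_of_neg hr (not_le.1 hneg)
    unfold metricMass at h
    linarith
  rw [exp_neg_two_mul] at h1
  exact (inv_le_one₀ (Real.exp_pos _)).1 (by linarith)

theorem IsRegularSolution.exp_le_three (hsol : IsRegularSolution T f₀ f lam mu) {t r : ℝ}
    (ht : t ∈ Ioo 0 T) (hr : 0 < r) (hm : 3 * mass f t r ≤ r) :
    Real.exp (2 * lam t r) ≤ 3 := by
  rw [hsol.mass_eq ht hr, metricMass, exp_neg_two_mul] at hm
  have hx := Real.exp_pos (2 * lam t r)
  have h1 : 1 / 3 ≤ (Real.exp (2 * lam t r))⁻¹ := by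
    by_contra hneg
    nlinarith [mul_pos hr (sub_pos.2 (not_le.1 hneg))]
  rw [one_div] at h1
  exact (inv_le_inv₀ (by norm_num) hx).1 h1

theorem IsRegularSolution.dr_lam_eq (hsol : IsRegularSolution T f₀ f lam mu) {t r : ℝ}
    (ht : t ∈ Ioo 0 T) (hr : 0 < r) :
    dr lam t r = (1 + (8 * Real.pi * r ^ 2 * rho f t r - 1) * Real.exp (2 * lam t r)) / (2 * r) := by
  have h := hsol.einstein₁ t r ht.1.le ht.2 hr
  rw [exp_neg_two_mul] at h
  have hx := Real.exp_pos (2 * lam t r)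
  rw [← h]
  field_simp
  ring

theorem IsRegularSolution.dr_mu_eq (hsol : IsRegularSolution T f₀ f lam mu) {t r : ℝ}
    (ht : t ∈ Ioo 0 T) (hr : 0 < r) :
    dr mu t r = ((8 * Real.pi * r ^ 2 * pres f t r + 1) * Real.exp (2 * lam t r) - 1) / (2 * r) := by
  have h := hsol.einstein₂ t r ht.1.le ht.2 hr
  rw [exp_neg_two_mul] at h
  have hx := Real.exp_pos (2 * lam t r)
  rw [← h]
  field_simp
  ring

theorem IsRegularSolution.hasDerivAt_mu_add_lam (hsol : IsRegularSolution T f₀ f lam mu) {t r : ℝ}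
    (ht : t ∈ Ioo 0 T) (hr : 0 < r) :
    HasDerivAt (fun η => mu t η + lam t η)
      (4 * Real.pi * r * Real.exp (2 * lam t r) * (rho f t r + pres f t r)) r := by
  refine ((hsol.mu_inside.hasDerivAt_r ht hr).add (hsol.lam_inside.hasDerivAt_r ht hr)).congr_deriv ?_
  rw [hsol.dr_mu_eq ht hr, hsol.dr_lam_eq ht hr]
  field_simp
  ring

theorem IsRegularSolution.tendsto_mu_add_lam (hsol : IsRegularSolution T f₀ f lam mu) {t : ℝ}
    (ht : t ∈ Ioo 0 T) : Tendsto (fun η => mu t η + lam t η) atTop (𝓝 0) := by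
  simpa using (hsol.mu_infty t ht.1.le ht.2).add (hsol.lam_infty t ht.1.le ht.2)

theorem IsRegularSolution.mu_add_lam_nonpos (hf₀ : IsCutoffData Rm Fm f₀) (hFm : 0 < Fm)
    (hsol : IsRegularSolution T f₀ f lam mu) {t r : ℝ} (ht : t ∈ Ioo 0 T) (hr : 0 < r) :
    mu t r + lam t r ≤ 0 := by
  have hmono : MonotoneOn (fun η => mu t η + lam t η) (Ioi 0) := by
    refine monotoneOn_of_deriv_nonneg (convex_Ioi 0) (fun η hη =>
      (hsol.hasDerivAt_mu_add_lam ht hη).continuousAt.continuousWithinAt) ?_ ?_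
    · intro η hη
      rw [interior_Ioi] at hη
      exact (hsol.hasDerivAt_mu_add_lam ht hη).differentiableAt.differentiableWithinAt
    · intro η hη
      rw [interior_Ioi] at hη
      have hη : 0 < η := hη
      rw [(hsol.hasDerivAt_mu_add_lam ht hη).deriv]
      have h1 := hsol.rho_nonneg hf₀ hFm ht.1.le ht.2 hη
      have h2 := hsol.pres_nonneg hf₀ hFm ht.1.le ht.2 hη
      positivity
  refine ge_of_tendsto (hsol.tendsto_mu_add_lam ht) ?_
  filter_upwards [eventually_ge_atTop r] with η hη
  exact hmono hr (hr.trans_le hη) hη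

/-- No matter at radii `≥ K` at time `t`. -/
def VacuumBeyond (f : ℝ → ℝ → ℝ → ℝ → ℝ) (t K : ℝ) : Prop :=
  ∀ r, K ≤ r → rho f t r = 0 ∧ pres f t r = 0 ∧ cur f t r = 0

theorem IsRegularSolution.exists_vacuumBeyond (hsol : IsRegularSolution T f₀ f lam mu) {T' : ℝ}
    (hT' : T' < T) (K₀ : ℝ) : ∃ K, K₀ < K ∧ 0 < K ∧ ∀ t, 0 ≤ t → t ≤ T' → VacuumBeyond f t K := by
  obtain ⟨K, hK⟩ := hsol.f_support T' hT'
  refine ⟨max (max K K₀) 0 + 1, ?_, by positivity, fun t ht htT' r hr => ?_⟩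
  · linarith [le_max_left (max K K₀) 0, le_max_right K K₀]
  · refine matter_eq_zero fun w F hF => ?_
    by_contra hne
    have hr0 : 0 < r := by linarith [le_max_right (max K K₀) 0]
    have := (hK t r w F ht htT' hr0 hF.le hne).1
    linarith [le_max_left (max K K₀) 0, le_max_left K K₀]

theorem IsRegularSolution.mu_eq_neg_lam (hsol : IsRegularSolution T f₀ f lam mu) {t K : ℝ}
    (ht : t ∈ Ioo 0 T) (hK : 0 < K) (hv : VacuumBeyond f t K) : mu t K = -lam t K := by
  have hder : ∀ η, K ≤ η → HasDerivAt (fun η => mu t η + lam t η) 0 η := fun η hη =>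
    (hsol.hasDerivAt_mu_add_lam ht (hK.trans_le hη)).congr_deriv (by
      rw [(hv η hη).1, (hv η hη).2.1]; ring)
  have hconst : ∀ η, K ≤ η → mu t η + lam t η = mu t K + lam t K := fun η hη =>
    constant_of_has_deriv_right_zero
      (fun y hy => (hder y hy.1).continuousAt.continuousWithinAt)
      (fun y hy => (hder y hy.1).hasDerivWithinAt) η ⟨hη, le_rfl⟩
  have : Tendsto (fun η => mu t η + lam t η) atTop (𝓝 (mu t K + lam t K)) :=
    tendsto_const_nhds.congr' (by
      filter_upwards [eventually_ge_atTop K] with η hη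
      exact (hconst η hη).symm)
  linarith [tendsto_nhds_unique this (hsol.tendsto_mu_add_lam ht)]

/-- The radial derivative of `μ̂`. -/
def muHatIntegrand (lam : ℝ → ℝ → ℝ) (t r : ℝ) : ℝ := (Real.exp (2 * lam t r) - 1) / (2 * r)

theorem IsRegularSolution.muHatIntegrand_inside (hsol : IsRegularSolution T f₀ f lam mu) :
    IsC1Inside T (muHatIntegrand lam) := by
  have h := hsol.lam_inside
  unfold IsC1Inside muHatIntegrand
  refine ContDiffOn.div (by fun_prop) (by fun_prop) fun z hz => ?_
  have : (0 : ℝ) < z.2 := hz.2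
  positivity

theorem IsRegularSolution.muHat_eq (hf₀ : IsCutoffData Rm Fm f₀) (hFm : 0 < Fm)
    (hsol : IsRegularSolution T f₀ f lam mu) {t r K : ℝ} (ht : t ∈ Ioo 0 T) (hr : 0 < r)
    (hK : 0 < K) (hv : VacuumBeyond f t K) :
    muHat f lam t r = -lam t K - ∫ η in r..K, muHatIntegrand lam t η := by
  have hcongr : ∫ η in Ioi r, Real.exp (2 * lam t η) * mass f t η / η ^ 2
      = ∫ η in Ioi r, muHatIntegrand lam t η := by
    refine setIntegral_congr_fun measurableSet_Ioi fun η hη => ?_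
    have hη0 : 0 < η := hr.trans hη
    have hx := Real.exp_pos (2 * lam t η)
    simp only [hsol.mass_eq ht hη0, metricMass, exp_neg_two_mul, muHatIntegrand]
    field_simp
  have hder : ∀ η ∈ Ici K, HasDerivAt (mu t) (muHatIntegrand lam t η) η := fun η hη => by
    have hη0 : 0 < η := hK.trans_le hη
    refine (hsol.mu_inside.hasDerivAt_r ht hη0).congr_deriv ?_
    rw [hsol.dr_mu_eq ht hη0, (hv η hη).2.1, muHatIntegrand]
    ring
  have hnn : ∀ η ∈ Ioi K, 0 ≤ muHatIntegrand lam t η := fun η hη => by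
    have hη0 : 0 < η := hK.trans hη
    have := hsol.one_le_exp hf₀ hFm ht hη0
    exact div_nonneg (by linarith) (by positivity)
  have hlim := hsol.mu_infty t ht.1.le ht.2
  have hI := integral_Ioi_of_hasDerivAt_of_nonneg' hder hnn hlim
  have hint := integrableOn_Ioi_deriv_of_nonneg' hder hnn hlim
  have hii := intervalIntegrable_of_continuousOn_Ioi
    (continuousOn_slice hsol.muHatIntegrand_inside.continuousOn ht) hr hK
  rw [muHat, hcongr, ← intervalIntegral.integral_interval_add_Ioi' hii hint, hI,
    hsol.mu_eq_neg_lam ht hK hv]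
  ring

theorem IsRegularSolution.mu_le_muHat (hf₀ : IsCutoffData Rm Fm f₀) (hFm : 0 < Fm)
    (hsol : IsRegularSolution T f₀ f lam mu) {t r K : ℝ} (ht : t ∈ Ioo 0 T) (hr : 0 < r)
    (hrK : r ≤ K) (hv : VacuumBeyond f t K) : mu t r ≤ muHat f lam t r := by
  have hK := hr.trans_le hrK
  rw [hsol.muHat_eq hf₀ hFm ht hr hK hv, ← hsol.mu_eq_neg_lam ht hK hv]
  have hc := continuousOn_slice hsol.dr_mu_inside.continuousOn ht
  have hii := intervalIntegrable_of_continuousOn_Ioi hc hr hK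
  have hFTC := intervalIntegral.integral_eq_sub_of_hasDerivAt (a := r) (b := K)
    (f := mu t) (f' := dr mu t)
    (fun η hη => hsol.mu_inside.hasDerivAt_r ht (uIcc_subset_Ioi_zero hr hK hη)) hii
  have hle : ∫ η in r..K, muHatIntegrand lam t η ≤ ∫ η in r..K, dr mu t η := by
    refine intervalIntegral.integral_mono_on hrK (intervalIntegrable_of_continuousOn_Ioi
      (continuousOn_slice hsol.muHatIntegrand_inside.continuousOn ht) hr hK) hii fun η hη => ?_
    have hη0 := hr.trans_le hη.1
    rw [hsol.dr_mu_eq ht hη0, muHatIntegrand]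
    have h1 := hsol.pres_nonneg hf₀ hFm ht.1.le ht.2 hη0
    have h2 : 0 ≤ 8 * Real.pi * η ^ 2 * pres f t η * Real.exp (2 * lam t η) := by positivity
    gcongr
    linarith
  linarith

theorem IsRegularSolution.lam_eq_of_vacuum (hsol : IsRegularSolution T f₀ f lam mu) {s t K : ℝ}
    (hs : 0 < s) (hst : s ≤ t) (htT : t < T) (hK : 0 < K)
    (hv : ∀ τ, 0 ≤ τ → τ ≤ t → VacuumBeyond f τ K) : lam t K = lam s K := by
  have hder : ∀ τ ∈ Icc s t, HasDerivAt (fun τ => lam τ K) 0 τ := fun τ hτ => by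
    have hτ0 : 0 < τ := hs.trans_le hτ.1
    have hτT : τ < T := hτ.2.trans_lt htT
    refine (hsol.lam_inside.hasDerivAt_t ⟨hτ0, hτT⟩ hK).congr_deriv ?_
    rw [hsol.einstein₃ τ K hτ0.le hτT hK, (hv τ hτ0.le hτ.2 K le_rfl).2.2, mul_zero]
  exact constant_of_has_deriv_right_zero
    (fun τ hτ => (hder τ hτ).continuousAt.continuousWithinAt)
    (fun τ hτ => (hder τ ⟨hτ.1, hτ.2.le⟩).hasDerivWithinAt) t ⟨hst, le_rfl⟩

/-- The time-flux density `λ_t e^{λ-μ}`. -/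
def fluxT (lam mu : ℝ → ℝ → ℝ) (t r : ℝ) : ℝ := dt lam t r * Real.exp (lam t r - mu t r)

/-- The radial flux `e^{μ-λ} (μ_r - μ̂_r)`. -/
def fluxR (lam mu : ℝ → ℝ → ℝ) (t r : ℝ) : ℝ :=
  Real.exp (mu t r - lam t r) * (dr mu t r - muHatIntegrand lam t r)

theorem IsRegularSolution.fluxT_inside (hsol : IsRegularSolution T f₀ f lam mu) :
    IsC1Inside T (fluxT lam mu) := by
  have h1 := hsol.lam_inside
  have h2 := hsol.mu_inside
  have h3 := hsol.dt_lam_inside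
  unfold IsC1Inside at *
  unfold fluxT
  fun_prop

theorem IsRegularSolution.fluxR_inside (hsol : IsRegularSolution T f₀ f lam mu) :
    IsC1Inside T (fluxR lam mu) := by
  have h1 := hsol.lam_inside
  have h2 := hsol.mu_inside
  have h3 := hsol.dr_mu_inside
  have h4 := hsol.muHatIntegrand_inside
  unfold IsC1Inside at *
  unfold fluxR
  fun_prop

theorem IsRegularSolution.fluxR_eq (hsol : IsRegularSolution T f₀ f lam mu) {t r : ℝ}
    (ht : t ∈ Ioo 0 T) (hr : 0 < r) :
    fluxR lam mu t r = 4 * Real.pi * r * Real.exp (mu t r - lam t r) * Real.exp (2 * lam t r)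
      * pres f t r := by
  rw [fluxR, hsol.dr_mu_eq ht hr, muHatIntegrand]
  field_simp
  ring

theorem IsRegularSolution.fluxT_nonneg (hf₀ : IsCutoffData Rm Fm f₀) (hFm : 0 < Fm)
    (hsol : IsRegularSolution T f₀ f lam mu) {t r : ℝ} (ht : t ∈ Ioo 0 T) (hr : 0 < r)
    (hj : curPlus f t r = 0) : 0 ≤ dt lam t r ∧ 0 ≤ fluxT lam mu t r := by
  have h1 : 0 ≤ dt lam t r := by
    rw [hsol.einstein₃ t r ht.1.le ht.2 hr]
    have h2 := hsol.cur_nonpos hf₀ hFm ht.1.le ht.2 hr hj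
    have h3 : 0 ≤ 4 * Real.pi * r * Real.exp (lam t r + mu t r) * -cur f t r :=
      mul_nonneg (by positivity) (by linarith)
    linarith
  exact ⟨h1, mul_nonneg h1 (Real.exp_pos _).le⟩

theorem IsRegularSolution.dt_muHatIntegrand (hsol : IsRegularSolution T f₀ f lam mu) {t r : ℝ}
    (ht : t ∈ Ioo 0 T) (hr : 0 < r) :
    deriv (fun τ => muHatIntegrand lam τ r) t = Real.exp (2 * lam t r) * dt lam t r / r := by
  have h := ((((hsol.lam_inside.hasDerivAt_t ht hr).const_mul 2).exp.sub_const 1).div_const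
    (2 * r)).deriv
  refine Eq.trans h ?_
  field_simp

/-- The matter source of the flux balance, an exact consequence of the field equations. -/
theorem IsRegularSolution.flux_balance (hsol : IsRegularSolution T f₀ f lam mu) {t r : ℝ}
    (ht : t ∈ Ioo 0 T) (hr : 0 < r) :
    deriv (fun τ => fluxT lam mu τ r) t - deriv (fluxR lam mu t) r
        - deriv (fun τ => muHatIntegrand lam τ r) t
      = 4 * Real.pi * Real.exp (mu t r + lam t r) * (pres f t r - tang f t r
        + (Real.exp (2 * lam t r) - 1) / 2 * (rho f t r + pres f t r)
        + (2 * ((Real.exp (2 * lam t r) - 1) / 2) + 1) * cur f t r) := by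
  have hl_t := hsol.lam_inside.hasDerivAt_t ht hr
  have hl_r := hsol.lam_inside.hasDerivAt_r ht hr
  have hm_t := hsol.mu_inside.hasDerivAt_t ht hr
  have hm_r := hsol.mu_inside.hasDerivAt_r ht hr
  have hl_tt := hsol.dt_lam_inside.hasDerivAt_t ht hr
  have hm_rr := hsol.dr_mu_inside.hasDerivAt_r ht hr
  have hT : deriv (fun τ => fluxT lam mu τ r) t = dt (dt lam) t r * Real.exp (lam t r - mu t r)
      + dt lam t r * (Real.exp (lam t r - mu t r) * (dt lam t r - dt mu t r)) :=
    (hl_tt.mul (hl_t.sub hm_t).exp).deriv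
  have hI : HasDerivAt (muHatIntegrand lam t)
      ((Real.exp (2 * lam t r) * (2 * dr lam t r) * (2 * r)
        - (Real.exp (2 * lam t r) - 1) * (2 * 1)) / (2 * r) ^ 2) r :=
    ((hl_r.const_mul 2).exp.sub_const 1).div ((hasDerivAt_id r).const_mul 2) (by positivity)
  have hR : deriv (fluxR lam mu t) r
      = Real.exp (mu t r - lam t r) * (dr mu t r - dr lam t r) * (dr mu t r - muHatIntegrand lam t r)
        + Real.exp (mu t r - lam t r) * (dr (dr mu) t r
          - (Real.exp (2 * lam t r) * (2 * dr lam t r) * (2 * r)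
            - (Real.exp (2 * lam t r) - 1) * (2 * 1)) / (2 * r) ^ 2) :=
    ((hm_r.sub hl_r).exp.mul (hm_rr.sub hI)).deriv
  have h3 := hsol.einstein₃ t r ht.1.le ht.2 hr
  have h4 := hsol.einstein₄ t r ht.1.le ht.2 hr
  have hlr := hsol.dr_lam_eq ht hr
  have hmr := hsol.dr_mu_eq ht hr
  rw [hsol.dt_muHatIntegrand ht hr, hT, hR]
  have e1 : Real.exp (2 * lam t r) = Real.exp (lam t r) ^ 2 := by
    rw [← Real.exp_nat_mul]; norm_num
  have e2 : Real.exp (-2 * lam t r) = (Real.exp (lam t r) ^ 2)⁻¹ := by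
    rw [exp_neg_two_mul, e1]
  have e3 : Real.exp (-2 * mu t r) = (Real.exp (mu t r) ^ 2)⁻¹ := by
    rw [exp_neg_two_mul, ← Real.exp_nat_mul]; norm_num
  rw [Real.exp_sub, Real.exp_sub, Real.exp_add, muHatIntegrand]
  rw [Real.exp_add] at h3
  rw [e2, e3] at h4
  rw [e1] at hlr hmr ⊢
  set L := Real.exp (lam t r)
  set N := Real.exp (mu t r)
  have hL : L ≠ 0 := (Real.exp_pos _).ne'
  have hN : N ≠ 0 := (Real.exp_pos _).ne'
  have h4' : dt (dt lam) t r + dt lam t r * (dt lam t r - dt mu t r)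
      = N ^ 2 * ((L ^ 2)⁻¹ * (dr (dr mu) t r + (dr mu t r - dr lam t r) * (dr mu t r + 1 / r))
        - 4 * Real.pi * tang f t r) := by
    rw [← h4]; field_simp; ring
  have hTT : dt (dt lam) t r * (L / N) + dt lam t r * (L / N * (dt lam t r - dt mu t r))
      = L / N * (N ^ 2 * ((L ^ 2)⁻¹ * (dr (dr mu) t r
        + (dr mu t r - dr lam t r) * (dr mu t r + 1 / r)) - 4 * Real.pi * tang f t r)) := by
    rw [← h4']; ring
  rw [hTT, h3, hlr, hmr]
  field_simp
  ring

theorem IsRegularSolution.flux_balance_le (hf₀ : IsCutoffData Rm Fm f₀) (hFm : 0 < Fm)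
    (hsol : IsRegularSolution T f₀ f lam mu) {t r : ℝ} (ht : t ∈ Ioo 0 T) (hr : 0 < r)
    (hj : curPlus f t r = 0) (hm : 3 * mass f t r ≤ r) :
    deriv (fun τ => fluxT lam mu τ r) t - deriv (fluxR lam mu t) r
        - deriv (fun τ => muHatIntegrand lam τ r) t
      ≤ Fm⁻¹ * deriv (metricMass lam t) r := by
  rw [hsol.flux_balance ht hr, (hsol.hasDerivAt_metricMass ht hr).deriv]
  have hθ : (Real.exp (2 * lam t r) - 1) / 2 ≤ 1 := by linarith [hsol.exp_le_three ht hr hm]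
  have h1 := hsol.matter_le hf₀ hFm ht.1.le ht.2 hr hj hθ
  have h2 := hsol.rho_nonneg hf₀ hFm ht.1.le ht.2 hr
  have h3 : Real.exp (mu t r + lam t r) ≤ 1 :=
    Real.exp_le_one_iff.2 (hsol.mu_add_lam_nonpos hf₀ hFm ht hr)
  calc _ ≤ 4 * Real.pi * Real.exp (mu t r + lam t r) * (r ^ 2 / Fm * rho f t r) := by gcongr
    _ ≤ 4 * Real.pi * 1 * (r ^ 2 / Fm * rho f t r) := by gcongr
    _ = _ := by ring

variable {r w F : ℝ} {R W : ℝ → ℝ}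

theorem IsCharacteristic.hasDerivAt_R (hchar : IsCharacteristic T lam mu r w F R W) {s : ℝ}
    (hs : s ∈ Ioo 0 T) :
    HasDerivAt R (Real.exp (mu s (R s) - lam s (R s)) * (W s / energy (R s) (W s) F)) s :=
  (hchar.deriv_R s (Ioo_subset_Ico_self hs)).hasDerivAt (Ici_mem_nhds hs.1)

theorem IsCharacteristic.antitoneOn_R (hchar : IsCharacteristic T lam mu r w F R W)
    (hW : ∀ s ∈ Ico 0 T, W s ≤ 0) : AntitoneOn R (Ico 0 T) := by
  refine antitoneOn_of_deriv_nonpos (convex_Ico 0 T) hchar.continuousOn_R ?_ ?_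
  · intro s hs
    rw [interior_Ico] at hs
    exact (hchar.hasDerivAt_R hs).differentiableAt.differentiableWithinAt
  · intro s hs
    rw [interior_Ico] at hs
    rw [(hchar.hasDerivAt_R hs).deriv]
    exact mul_nonpos_of_nonneg_of_nonpos (Real.exp_pos _).le
      (div_nonpos_of_nonpos_of_nonneg (hW s (Ioo_subset_Ico_self hs)) (Real.sqrt_nonneg _))

theorem IsCharacteristic.hasDerivAt_log_energy (hchar : IsCharacteristic T lam mu r w F R W)
    (hF : 0 ≤ F) {s : ℝ} (hs : s ∈ Ioo 0 T) :
    HasDerivAt (fun σ => Real.log (energy (R σ) (W σ) F))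
      (-(W s / energy (R s) (W s) F) * (dt lam s (R s) * (W s / energy (R s) (W s) F)
        + Real.exp (mu s (R s) - lam s (R s)) * dr mu s (R s))) s := by
  have hs' := Ioo_subset_Ico_self hs
  have hpos := hchar.pos s hs'
  have hR := hchar.hasDerivAt_R hs
  have hW := (hchar.deriv_W s hs').hasDerivAt (Ici_mem_nhds hs.1)
  have hE := energy_pos (r := R s) (w := W s) hF
  have hA : HasDerivAt (fun σ => 1 + W σ ^ 2 + F / R σ ^ 2) _ s :=
    ((hW.pow 2).const_add 1).add ((hasDerivAt_const s F).div (hR.pow 2) (by positivity))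
  have hS := hA.sqrt (by positivity)
  have hL := hS.log (Real.sqrt_pos.2 (by positivity)).ne'
  refine hL.congr_deriv ?_
  change _ / (2 * energy (R s) (W s) F) / energy (R s) (W s) F = _
  field_simp
  simp only [Nat.cast_ofNat]
  ring

theorem IsCharacteristic.hasDerivAt_muHat (hf₀ : IsCutoffData Rm Fm f₀) (hFm : 0 < Fm)
    (hsol : IsRegularSolution T f₀ f lam mu) (hchar : IsCharacteristic T lam mu r w F R W)
    {s T' K : ℝ} (hs : s ∈ Ioo 0 T') (hT' : T' < T) (hK : 0 < K)
    (hv : ∀ τ, 0 ≤ τ → τ ≤ T' → VacuumBeyond f τ K) :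
    HasDerivAt (fun σ => muHat f lam σ (R σ))
      (muHatIntegrand lam s (R s)
          * (Real.exp (mu s (R s) - lam s (R s)) * (W s / energy (R s) (W s) F))
        - ∫ η in R s..K, deriv (fun τ => muHatIntegrand lam τ η) s) s := by
  have hsT : s ∈ Ioo 0 T := ⟨hs.1, hs.2.trans hT'⟩
  have h1 := hasDerivAt_integral_moving isOpen_Ioo hsol.muHatIntegrand_inside hsT
    (hchar.hasDerivAt_R hsT) (hchar.pos s (Ioo_subset_Ico_self hsT)) hK
  have h2 : HasDerivAt (fun σ => lam σ K) 0 s :=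
    (hsol.lam_inside.hasDerivAt_t hsT hK).congr_deriv (by
      rw [hsol.einstein₃ s K hsT.1.le hsT.2 hK, (hv s hs.1.le hs.2.le K le_rfl).2.2, mul_zero])
  refine ((h2.neg.sub h1).congr_deriv (by ring)).congr_of_eventuallyEq ?_
  filter_upwards [Ioo_mem_nhds hs.1 hs.2] with σ hσ
  have hσT : σ ∈ Ioo 0 T := ⟨hσ.1, hσ.2.trans hT'⟩
  exact hsol.muHat_eq hf₀ hFm hσT (hchar.pos σ (Ioo_subset_Ico_self hσT)) hK
    (hv σ hσ.1.le hσ.2.le)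

/-- The logarithm of `e^{μ̂} E` along a characteristic, corrected by the time flux through the region
between the characteristic and the radius `K`. -/
def correctedLogEnergy (f : ℝ → ℝ → ℝ → ℝ → ℝ) (lam mu : ℝ → ℝ → ℝ) (F : ℝ) (R W : ℝ → ℝ)
    (K s : ℝ) : ℝ :=
  muHat f lam s (R s) + Real.log (energy (R s) (W s) F) + ∫ η in R s..K, fluxT lam mu s η

theorem IsCharacteristic.correctedLogEnergy_growth (hf₀ : IsCutoffData Rm Fm f₀) (hFm : 0 < Fm)
    (hsol : IsRegularSolution T f₀ f lam mu) (hchar : IsCharacteristic T lam mu r w F R W)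
    (hF : 0 ≤ F) (hj : ∀ t r, 0 ≤ t → t < T → 0 < r → curPlus f t r = 0)
    (hm : ∀ t r, 0 ≤ t → t < T → 0 < r → 3 * mass f t r ≤ r)
    (hW : ∀ s ∈ Ico 0 T, W s ≤ 0)
    (hmono : ∀ s ∈ Ico 0 T, 0 ≤ derivWithin (fun σ => Real.exp (muHat f lam σ (R σ))
        * energy (R σ) (W σ) F) (Ici 0) s)
    {s T' K : ℝ} (hs : s ∈ Ioo 0 T') (hT' : T' < T) (hRK : R s ≤ K)
    (hv : ∀ τ, 0 ≤ τ → τ ≤ T' → VacuumBeyond f τ K) :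
    ∃ D, HasDerivAt (correctedLogEnergy f lam mu F R W K) D s ∧ D ≤ Fm⁻¹ * metricMass lam s K := by
  have hsT : s ∈ Ioo 0 T := ⟨hs.1, hs.2.trans hT'⟩
  have hs' := Ioo_subset_Ico_self hsT
  have hpos := hchar.pos s hs'
  have hK : 0 < K := hpos.trans_le hRK
  have hE := energy_pos (r := R s) (w := W s) hF
  have hmu := hchar.hasDerivAt_muHat hf₀ hFm hsol hs hT' hK hv
  have hlog := hchar.hasDerivAt_log_energy hF hsT
  have hflux := hasDerivAt_integral_moving isOpen_Ioo hsol.fluxT_inside hsT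
    (hchar.hasDerivAt_R hsT) hpos hK
  have hcur := hj s (R s) hsT.1.le hsT.2 hpos
  have hlt := (hsol.fluxT_nonneg hf₀ hFm hsT hpos hcur).1
  set v := W s / energy (R s) (W s) F with hv_def
  have hv0 : v ≤ 0 := div_nonpos_of_nonpos_of_nonneg (hW s hs') hE.le
  have hv1 : -1 ≤ v := by
    rw [hv_def, le_div_iff₀ hE]
    linarith [neg_abs_le (W s), abs_le_energy (r := R s) (w := W s) hF]
  set I := ∫ η in R s..K, deriv (fun τ => muHatIntegrand lam τ η) s with hI_def
  have hI0 : 0 ≤ I := by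
    refine intervalIntegral.integral_nonneg hRK fun η hη => ?_
    have hη0 := hpos.trans_le hη.1
    rw [hsol.dt_muHatIntegrand hsT hη0]
    have := (hsol.fluxT_nonneg hf₀ hFm hsT hη0 (hj s η hsT.1.le hsT.2 hη0)).1
    positivity
  set α := fluxR lam mu s (R s) + dt lam s (R s) * v with hα_def
  have hsum : HasDerivAt (fun σ => muHat f lam σ (R σ) + Real.log (energy (R σ) (W σ) F))
      (-v * α - I) s := by
    refine (hmu.add hlog).congr_deriv ?_
    rw [hα_def, fluxR]
    ring
  have hα : 0 ≤ α := by
    rcases hv0.eq_or_lt with h0 | hneg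
    · have hp := hsol.pres_nonneg hf₀ hFm hsT.1.le hsT.2 hpos
      rw [hα_def, h0, mul_zero, add_zero, hsol.fluxR_eq hsT hpos]
      positivity
    · have hexp : HasDerivAt (fun σ => Real.exp (muHat f lam σ (R σ)) * energy (R σ) (W σ) F) _ s :=
        hsum.exp.congr_of_eventuallyEq (Eventually.of_forall fun σ => by
          simp only [Real.exp_add]
          rw [Real.exp_log (energy_pos hF)])
      have h2 := hmono s hs'
      rw [derivWithin_Ici_eq_deriv _ hsT.1, hexp.deriv] at h2
      have h3 := nonneg_of_mul_nonneg_right h2 (Real.exp_pos _)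
      exact nonneg_of_mul_nonneg_right (by linarith : 0 ≤ -v * α) (by linarith)
  refine ⟨_, hsum.add hflux, ?_⟩
  have cT := continuousOn_deriv_fst isOpen_Ioo hsol.fluxT_inside hsT
  have cR := continuousOn_deriv_snd isOpen_Ioo hsol.fluxR_inside hsT
  have cI := continuousOn_deriv_fst isOpen_Ioo hsol.muHatIntegrand_inside hsT
  have cM := continuousOn_deriv_snd isOpen_Ioo hsol.metricMass_inside hsT
  have iT := intervalIntegrable_of_continuousOn_Ioi cT hpos hK
  have iR := intervalIntegrable_of_continuousOn_Ioi cR hpos hK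
  have iI := intervalIntegrable_of_continuousOn_Ioi cI hpos hK
  have iM := intervalIntegrable_of_continuousOn_Ioi cM hpos hK
  have hle := intervalIntegral.integral_mono_on hRK ((iT.sub iR).sub iI) (iM.const_mul Fm⁻¹)
    fun η hη => hsol.flux_balance_le hf₀ hFm hsT (hpos.trans_le hη.1)
      (hj s η hsT.1.le hsT.2 (hpos.trans_le hη.1)) (hm s η hsT.1.le hsT.2 (hpos.trans_le hη.1))
  rw [intervalIntegral.integral_sub (iT.sub iR) iI, intervalIntegral.integral_sub iT iR,
    intervalIntegral.integral_const_mul,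
    intervalIntegral.integral_deriv_eq_sub (fun η hη => (hasDerivAt_snd_of_contDiffOn isOpen_Ioo
      hsol.fluxR_inside hsT (uIcc_subset_Ioi_zero hpos hK hη)).differentiableAt) iR,
    intervalIntegral.integral_deriv_eq_sub (fun η hη => (hasDerivAt_snd_of_contDiffOn isOpen_Ioo
      hsol.metricMass_inside hsT (uIcc_subset_Ioi_zero hpos hK hη)).differentiableAt) iM,
    hsol.fluxR_eq hsT hK, (hv s hs.1.le hs.2.le K le_rfl).2.1, mul_zero, ← hI_def] at hle
  have hbR : fluxT lam mu s (R s) * (Real.exp (mu s (R s) - lam s (R s)) * v)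
      = dt lam s (R s) * v := by
    rw [fluxT, mul_assoc, ← mul_assoc (Real.exp _) (Real.exp _), ← Real.exp_add]
    simp
  rw [hbR]
  have hMR := mul_nonneg (inv_nonneg.2 hFm.le) (hsol.metricMass_nonneg hf₀ hFm hsT hpos)
  have hlast := mul_nonneg (by linarith : 0 ≤ 1 + v) hα
  nlinarith [hlast, hMR, hle]

theorem IsRegularSolution.metricMass_eq_of_vacuum (hsol : IsRegularSolution T f₀ f lam mu)
    {s K₁ K₂ : ℝ} (hs : s ∈ Ioo 0 T) (hK₁ : 0 < K₁) (hK : K₁ ≤ K₂) (hv : VacuumBeyond f s K₁) :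
    metricMass lam s K₂ = metricMass lam s K₁ := by
  have hder : ∀ η, K₁ ≤ η → HasDerivAt (metricMass lam s) 0 η := fun η hη =>
    (hsol.hasDerivAt_metricMass hs (hK₁.trans_le hη)).congr_deriv (by rw [(hv η hη).1, mul_zero])
  exact constant_of_has_deriv_right_zero
    (fun y hy => (hder y hy.1).continuousAt.continuousWithinAt)
    (fun y hy => (hder y hy.1).hasDerivWithinAt) K₂ ⟨hK, le_rfl⟩

theorem IsRegularSolution.integral_fluxT_eq_of_vacuum (hsol : IsRegularSolution T f₀ f lam mu)
    {s a K₁ K₂ : ℝ} (hs : s ∈ Ioo 0 T) (ha : 0 < a) (hK₁ : 0 < K₁) (hK : K₁ ≤ K₂)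
    (hv : VacuumBeyond f s K₁) :
    ∫ η in a..K₂, fluxT lam mu s η = ∫ η in a..K₁, fluxT lam mu s η := by
  have hc := continuousOn_slice hsol.fluxT_inside.continuousOn hs
  rw [← intervalIntegral.integral_add_adjacent_intervals
    (intervalIntegrable_of_continuousOn_Ioi hc ha hK₁)
    (intervalIntegrable_of_continuousOn_Ioi hc hK₁ (hK₁.trans_le hK)), add_eq_left]
  refine intervalIntegral.integral_zero_ae (Eventually.of_forall fun η hη => ?_)
  rw [uIoc_of_le hK] at hη
  rw [fluxT, hsol.einstein₃ s η hs.1.le hs.2 (hK₁.trans hη.1), (hv η hη.1.le).2.2]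
  simp

/-- The particle energy `e^{μ̂} E` stays bounded along the characteristic. -/
theorem IsCharacteristic.exists_log_bound (hf₀ : IsCutoffData Rm Fm f₀) (hFm : 0 < Fm)
    (hsol : IsRegularSolution T f₀ f lam mu) (hchar : IsCharacteristic T lam mu r w F R W)
    (hF : 0 ≤ F) (hj : ∀ t r, 0 ≤ t → t < T → 0 < r → curPlus f t r = 0)
    (hm : ∀ t r, 0 ≤ t → t < T → 0 < r → 3 * mass f t r ≤ r)
    (hW : ∀ s ∈ Ico 0 T, W s ≤ 0)
    (hmono : ∀ s ∈ Ico 0 T, 0 ≤ derivWithin (fun σ => Real.exp (muHat f lam σ (R σ))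
        * energy (R σ) (W σ) F) (Ici 0) s) {s₀ : ℝ} (hs₀ : s₀ ∈ Ioo 0 T) :
    ∃ B, ∀ s ∈ Ico s₀ T, mu s (R s) + Real.log (energy (R s) (W s) F) ≤ B := by
  obtain ⟨K₀, hRK₀, hK₀, hv₀⟩ := hsol.exists_vacuumBeyond hs₀.2 (R s₀)
  have hvs₀ := hv₀ s₀ hs₀.1.le le_rfl
  have hR₀ := hchar.pos s₀ (Ioo_subset_Ico_self hs₀)
  set C := Fm⁻¹ * metricMass lam s₀ K₀ with hC
  have hC0 : 0 ≤ C := mul_nonneg (inv_nonneg.2 hFm.le) (hsol.metricMass_nonneg hf₀ hFm hs₀ hK₀)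
  refine ⟨correctedLogEnergy f lam mu F R W K₀ s₀ + C * T, fun s hs => ?_⟩
  have hsT : s ∈ Ioo 0 T := ⟨hs₀.1.trans_le hs.1, hs.2⟩
  obtain ⟨T', hsT', hT'⟩ := exists_between hs.2
  obtain ⟨K, hK₀K, hK, hv⟩ := hsol.exists_vacuumBeyond hT' K₀
  have hRle : ∀ σ ∈ Icc s₀ s, R σ ≤ K := fun σ hσ =>
    (hchar.antitoneOn_R hW (Ioo_subset_Ico_self hs₀)
      ⟨hs₀.1.le.trans hσ.1, hσ.2.trans_lt hs.2⟩ hσ.1).trans (hRK₀.trans hK₀K).le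
  have hmass : ∀ σ ∈ Icc s₀ s, Fm⁻¹ * metricMass lam σ K = C := fun σ hσ => by
    rw [hC, ← hsol.metricMass_eq_of_vacuum hs₀ hK₀ hK₀K.le hvs₀, metricMass, metricMass,
      hsol.lam_eq_of_vacuum hs₀.1 hσ.1 (hσ.2.trans_lt hs.2) hK
        fun τ h0 hτ => hv τ h0 (hτ.trans (hσ.2.trans hsT'.le))]
  have hder : ∀ σ ∈ Icc s₀ s, ∃ D, HasDerivAt (correctedLogEnergy f lam mu F R W K) D σ ∧ D ≤ C :=
    fun σ hσ => by
      rw [← hmass σ hσ]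
      exact hchar.correctedLogEnergy_growth hf₀ hFm hsol hF hj hm hW hmono
        ⟨hs₀.1.trans_le hσ.1, hσ.2.trans_lt hsT'⟩ hT' (hRle σ hσ) hv
  have hgrow := Convex.image_sub_le_mul_sub_of_deriv_le (convex_Icc s₀ s)
    (f := correctedLogEnergy f lam mu F R W K) (C := C)
    (fun σ hσ => (hder σ hσ).choose_spec.1.continuousAt.continuousWithinAt)
    (fun σ hσ => (hder σ (interior_subset hσ)).choose_spec.1.differentiableAt.differentiableWithinAt)
    (fun σ hσ => by
      obtain ⟨D, h1, h2⟩ := hder σ (interior_subset hσ)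
      rwa [h1.deriv]) s₀ ⟨le_rfl, hs.1⟩ s ⟨hs.1, le_rfl⟩ hs.1
  have hstart : correctedLogEnergy f lam mu F R W K s₀ = correctedLogEnergy f lam mu F R W K₀ s₀ := by
    rw [correctedLogEnergy, hsol.integral_fluxT_eq_of_vacuum hs₀ hR₀ hK₀ hK₀K.le hvs₀,
      correctedLogEnergy]
  have hRs := hchar.pos s (Ioo_subset_Ico_self hsT)
  have hRsK := hRle s ⟨hs.1, le_rfl⟩
  have hΦ : 0 ≤ ∫ η in R s..K, fluxT lam mu s η :=
    intervalIntegral.integral_nonneg hRsK fun η hη =>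
      (hsol.fluxT_nonneg hf₀ hFm hsT (hRs.trans_le hη.1)
        (hj s η hsT.1.le hsT.2 (hRs.trans_le hη.1))).2
  have hmu := hsol.mu_le_muHat hf₀ hFm hsT hRs hRsK (hv s hsT.1.le hsT'.le)
  have hCT : C * (s - s₀) ≤ C * T := by
    refine mul_le_mul_of_nonneg_left ?_ hC0
    linarith [hs₀.1, hs.2]
  have hdef : correctedLogEnergy f lam mu F R W K s = muHat f lam s (R s)
    + Real.log (energy (R s) (W s) F) + ∫ η in R s..K, fluxT lam mu s η := rfl
  linarith

theorem IsCharacteristic.exists_lower_bound (hT : 0 < T) (hf₀ : IsCutoffData Rm Fm f₀)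
    (hFm : 0 < Fm)
    (hsol : IsRegularSolution T f₀ f lam mu) (hchar : IsCharacteristic T lam mu r w F R W)
    (hF : 0 < F) (hj : ∀ t r, 0 ≤ t → t < T → 0 < r → curPlus f t r = 0)
    (hm : ∀ t r, 0 ≤ t → t < T → 0 < r → 3 * mass f t r ≤ r)
    (hW : ∀ s ∈ Ico 0 T, W s ≤ 0)
    (hmono : ∀ s ∈ Ico 0 T, 0 ≤ derivWithin (fun σ => Real.exp (muHat f lam σ (R σ))
        * energy (R σ) (W σ) F) (Ici 0) s) :
    ∃ ε : ℝ, 0 < ε ∧ ∀ s ∈ Ico 0 T, ε < R s := by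
  have hs₀ : T / 2 ∈ Ioo 0 T := ⟨by linarith, by linarith⟩
  obtain ⟨B, hB⟩ := hchar.exists_log_bound hf₀ hFm hsol hF.le hj hm hW hmono hs₀
  have hR₀ := hchar.pos _ (Ioo_subset_Ico_self hs₀)
  set C := Real.exp B / √F with hC
  have hsqrt : 0 < √F := Real.sqrt_pos.2 hF
  have hC0 : 0 < C := by positivity
  have hspeed : ∀ s ∈ Ico (T / 2) T, -(C * R s) ≤ Real.exp (mu s (R s) - lam s (R s))
      * (W s / energy (R s) (W s) F) := fun s hs => by
    have hsT : s ∈ Ioo 0 T := ⟨hs₀.1.trans_le hs.1, hs.2⟩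
    have hRs := hchar.pos s (Ioo_subset_Ico_self hsT)
    have hE := energy_pos (r := R s) (w := W s) hF.le
    have h1 : Real.exp (mu s (R s)) * energy (R s) (W s) F ≤ Real.exp B := by
      rw [← Real.exp_log hE, ← Real.exp_add]
      exact Real.exp_le_exp.2 (hB s hs)
    have h2 : √F / R s ≤ energy (R s) (W s) F := by
      rw [energy]
      refine Real.le_sqrt_of_sq_le ?_
      rw [div_pow, Real.sq_sqrt hF.le]
      nlinarith [sq_nonneg (W s)]
    have h3 : 0 ≤ lam s (R s) := by
      have := Real.one_le_exp_iff.1 (hsol.one_le_exp hf₀ hFm hsT hRs)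
      linarith
    have h4 : Real.exp (mu s (R s)) ≤ C * R s := by
      have h5 : Real.exp (mu s (R s)) * (√F / R s) ≤ Real.exp B :=
        (mul_le_mul_of_nonneg_left h2 (Real.exp_pos _).le).trans h1
      rw [hC, div_mul_eq_mul_div, le_div_iff₀ hsqrt]
      rwa [← mul_div_assoc, div_le_iff₀ hRs] at h5
    have h6 : Real.exp (mu s (R s) - lam s (R s)) ≤ C * R s :=
      (Real.exp_le_exp.2 (by linarith)).trans h4
    have h7 : -1 ≤ W s / energy (R s) (W s) F := by
      rw [le_div_iff₀ hE]
      linarith [neg_abs_le (W s), abs_le_energy (r := R s) (w := W s) hF.le]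
    nlinarith [Real.exp_pos (mu s (R s) - lam s (R s))]
  have hder : ∀ s ∈ Ico (T / 2) T, HasDerivAt (fun σ => R σ * Real.exp (C * σ))
      (Real.exp (mu s (R s) - lam s (R s)) * (W s / energy (R s) (W s) F) * Real.exp (C * s)
        + R s * (Real.exp (C * s) * (C * 1))) s := fun s hs =>
    (hchar.hasDerivAt_R ⟨hs₀.1.trans_le hs.1, hs.2⟩).mul ((hasDerivAt_id s).const_mul C).exp
  have hmonoR : MonotoneOn (fun σ => R σ * Real.exp (C * σ)) (Ico (T / 2) T) := by
    refine monotoneOn_of_deriv_nonneg (convex_Ico _ _)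
      (fun s hs => (hder s hs).continuousAt.continuousWithinAt)
      (fun s hs => (hder s (interior_subset hs)).differentiableAt.differentiableWithinAt)
      fun s hs => ?_
    rw [(hder s (interior_subset hs)).deriv]
    have := mul_nonneg (by linarith [hspeed s (interior_subset hs)] :
      0 ≤ Real.exp (mu s (R s) - lam s (R s)) * (W s / energy (R s) (W s) F) + C * R s)
      (Real.exp_pos (C * s)).le
    linarith
  have hlate : ∀ s ∈ Ico (T / 2) T, R (T / 2) * Real.exp (-(C * T)) ≤ R s := fun s hs => by
    have h1 : R (T / 2) * Real.exp (C * (T / 2)) ≤ R s * Real.exp (C * s) :=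
      hmonoR ⟨le_rfl, hs₀.2⟩ hs hs.1
    have hRs := hchar.pos s ⟨hs₀.1.le.trans hs.1, hs.2⟩
    have h2 : R (T / 2) ≤ R s * Real.exp (C * T) :=
      calc R (T / 2) ≤ R (T / 2) * Real.exp (C * (T / 2)) :=
            le_mul_of_one_le_right hR₀.le (Real.one_le_exp (by positivity))
        _ ≤ R s * Real.exp (C * s) := h1
        _ ≤ R s * Real.exp (C * T) := by
            have := hs.2.le
            gcongr
    rwa [Real.exp_neg, ← div_eq_mul_inv, div_le_iff₀ (Real.exp_pos _)]
  have hε : 0 < R (T / 2) * Real.exp (-(C * T)) := by positivity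
  have hsmall : R (T / 2) * Real.exp (-(C * T)) ≤ R (T / 2) :=
    mul_le_of_le_one_right hR₀.le (Real.exp_le_one_iff.2 (by
      have : 0 ≤ C * T := by positivity
      linarith))
  refine ⟨R (T / 2) * Real.exp (-(C * T)) / 2, by positivity, fun s hs => ?_⟩
  rcases le_or_gt (T / 2) s with h | h
  · linarith [hlate s ⟨h, hs.2⟩]
  · linarith [hchar.antitoneOn_R hW hs (Ioo_subset_Ico_self hs₀) h.le]

end EinsteinVlasov

end

theorem theorem3
    (T : ℝ) (hT : 0 < T)
    (Rm Fm : ℝ) (hRm : 0 < Rm) (hFm : 0 < Fm)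
    (f₀ : ℝ → ℝ → ℝ → ℝ) (hf₀ : EinsteinVlasov.IsCutoffData Rm Fm f₀)
    (hin : ∀ r w F, 0 ≤ r → 0 ≤ F → 0 < w → f₀ r w F = 0)
    (f : ℝ → ℝ → ℝ → ℝ → ℝ) (lam mu : ℝ → ℝ → ℝ)
    (hsol : EinsteinVlasov.IsRegularSolution T f₀ f lam mu)
    (hj : ∀ t r, 0 ≤ t → t < T → 0 < r → EinsteinVlasov.curPlus f t r = 0)
    (hm : ∀ t r, 0 ≤ t → t < T → 0 < r → 3 * EinsteinVlasov.mass f t r ≤ r)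
    (r w F : ℝ) (hF : 0 ≤ F) (R W : ℝ → ℝ)
    (hchar : EinsteinVlasov.IsCharacteristic T lam mu r w F R W)
    (hne : f₀ r w F ≠ 0)
    (hmono : ∀ s ∈ Set.Ico 0 T,
      0 ≤ derivWithin (fun σ => Real.exp (EinsteinVlasov.muHat f lam σ (R σ))
        * EinsteinVlasov.energy (R σ) (W σ) F) (Set.Ici 0) s) :
    ∃ ε : ℝ, 0 < ε ∧ ∀ s ∈ Set.Ico 0 T, ε < R s := by
  have hr : 0 < r := hchar.start_R ▸ hchar.pos 0 ⟨le_rfl, hT⟩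
  have hFpos : 0 < F := by
    by_contra h
    exact hne (hf₀.angular_cutoff r w F hr.le hF ((not_lt.1 h).trans hFm.le))
  refine hchar.exists_lower_bound hT hf₀ hFm hsol hFpos hj hm (fun s hs => ?_) hmono
  by_contra hpos
  have hRs := hchar.pos s hs
  exact hne (by rw [← hchar.f_eq hsol hFpos hs,
    hsol.f_eq_zero_of_pos hf₀ hFm hs.1 hs.2 hRs (hj s (R s) hs.1 hs.2 hRs) (not_le.1 hpos) hFpos])
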